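/- Let $(\mathcal M,\mathbf g)$ be a smooth 4-dimensional Lorentzian manifold of signature $(-,+,+,+)$ with Levi-Civita connection $\mathbf D$, and let $\mathcal H\subset\mathcal M$ be a smooth null hypersurface (possibly with boundary) with null normal $L$ tangent to $\mathcal H$, $\mathbf D_LL=0$. Let $s$ be the affine parameter, i.e. $s$ is a smooth function on $\mathcal H$ with $Ls=1$ and $s=1$ on a spacelike surface $S=\{s=1\}$ (for instance a 2-sphere); assume that $\mathcal H$ emanates from $S$, i.e. $s\ge 1$ and each point of $\mathcal H$ is joined to $S$ by an integral curve of $L$. The level sets $S'_s$ of $s$ form the geodesic foliation. Let $v$ be a smooth function on $\mathcal H$ with $v=1$ on $S$ and $\Omega:=Lv>0$, with level sets $S_v$ (for instance the canonical foliation). For the foliation $(S_v)$ let $\underline L$ be the null vector field along $\mathcal H$ orthogonal to the leaves with $\mathbf g(L,\underline L)=-2$. For $X,Y$ tangent to the leaves put $$\chi(X,Y)=\mathbf g(\mathbf D_XL,Y),\quad \underline\chi(X,Y)=\mathbf g(\mathbf D_X\underline L,Y),\quad \zeta(X)=\tfrac12\mathbf g(\mathbf D_XL,\underline L),\quad \underline\eta(X)=\tfrac12\mathbf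 g(\mathbf D_L\underline L,X).$$ Let $\nabla$ be the induced covariant derivative on the leaves $S_v$, and let $\nabla_L$ be the projection of $\mathbf D_L$ onto the leaves. Denote by a prime the same objects for the geodesic foliation $(S'_s)$. Let $(e_1,e_2)$ and $(e'_1,e'_2)$ be smooth orthonormal frames tangent to the leaves of $(S_v)$ and of $(S'_s)$ respectively, with $\nabla_Le_A=0$ and $\nabla'_Le'_A=0$ (Fermi propagated) and with $e'_A=e_A$ on $S$; they are defined on an open subset of $\mathcal H$ which contains, with each point, the generator from $S$ to that point. For an $S'_s$-tangent tensor $\phi'$ let $\phi'^\dagger$ be the $S_v$-tangent tensor with $\phi'^\dagger(e_{A_1},\dots,e_{A_r})=\phi'(e'_{A_1},\dots,e'_{A_r})$. Let $\Upsilon:=\nabla s$, the $S_v$-tangent 1-form $X\mapsto X(s)$. Then, with indices referring to $(e_1,e_2)$ and repeated indices summed, $$\chi_{AB}=\chi'^\dagger_{AB},\qquad \zeta_A=\zeta'^\dagger_A+\chi'^\dagger_{AB}\Upsilon_B,\qquad \underline\eta_A=\underline\eta'^\dagger_A+\nabla_L\Upsilon_A,$$ $$\underline\chi_{AB}=\underline\chi'^\dagger_{AB}+2\Upsilon_A\underline\eta'^\dagger_B-2\zeta'^\dagger_A\Upsilon_B+2\nabla_A\Upsilon_B-|\Upsilon|^2\chi'^\dagger_{AB}.$$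 -/

import Mathlib

open scoped Manifold ContDiff

noncomputable section

namespace NullGeometry

/-- A smooth Lorentzian metric, of signature `(-,+,+,+)`, on a 4-manifold. -/
structure LorentzMetric (M : Type*) [TopologicalSpace M]
    [ChartedSpace (EuclideanSpace ℝ (Fin 4)) M] [IsManifold (𝓡 4) ∞ M] where
  /-- The bilinear form on each tangent space. -/
  form : ∀ x : M, TangentSpace (𝓡 4) x →L[ℝ] TangentSpace (𝓡 4) x →L[ℝ] ℝ
  symm : ∀ (x : M) (u w : TangentSpace (𝓡 4) x), form x u w = form x w u
  signature : ∀ x : M, ∃ b : Module.Basis (Fin 4) ℝ (TangentSpace (𝓡 4) x),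
    ∀ i j, form x (b i) (b j) = if i = j then (if i = 0 then -1 else 1) else 0
  smooth : ContMDiff (𝓡 4)
    ((𝓡 4).prod 𝓘(ℝ, EuclideanSpace ℝ (Fin 4) →L[ℝ] EuclideanSpace ℝ (Fin 4) →L[ℝ] ℝ)) ∞
    (fun x ↦ Bundle.TotalSpace.mk'
      (EuclideanSpace ℝ (Fin 4) →L[ℝ] EuclideanSpace ℝ (Fin 4) →L[ℝ] ℝ)
      (E := fun x : M ↦ TangentSpace (𝓡 4) x →L[ℝ] TangentSpace (𝓡 4) x →L[ℝ] ℝ) x (form x))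

section Connection

variable {M : Type*} [TopologicalSpace M] [ChartedSpace (EuclideanSpace ℝ (Fin 4)) M]
  [IsManifold (𝓡 4) ∞ M]

/-- The coordinate vector field `∂_i` of the preferred chart at `x₀`, evaluated at `x`. -/
def coordField (x₀ : M) (i : Fin 4) (x : M) : TangentSpace (𝓡 4) x :=
  (trivializationAt (EuclideanSpace ℝ (Fin 4)) (TangentSpace (𝓡 4)) x₀).symmL ℝ x
    (EuclideanSpace.single i (1 : ℝ))

/-- The metric component `g_ij` in the preferred chart at `x₀`, as a function near `x₀`. -/
def LorentzMetric.component (g : LorentzMetric M) (x₀ : M) (i j : Fin 4) (x : M) : ℝ :=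
  g.form x (coordField x₀ i x) (coordField x₀ j x)

/-- The coordinate derivative `∂_k g_ij` at `x₀`, in the preferred chart at `x₀`. -/
def LorentzMetric.dComponent (g : LorentzMetric M) (x₀ : M) (k i j : Fin 4) : ℝ :=
  mfderiv (𝓡 4) 𝓘(ℝ, ℝ) (g.component x₀ i j) x₀ (coordField x₀ k x₀)

/-- The Christoffel symbol `Γ^k_ij = ½ g^{kl} (∂_i g_jl + ∂_j g_il - ∂_l g_ij)` at `x₀`, in the
preferred chart at `x₀`. -/
def LorentzMetric.christoffel (g : LorentzMetric M) (x₀ : M) (k i j : Fin 4) : ℝ :=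
  (1 / 2) * ∑ l, (Matrix.of fun a b ↦ g.component x₀ a b x₀)⁻¹ k l *
    (g.dComponent x₀ i j l + g.dComponent x₀ j i l - g.dComponent x₀ l i j)

/-- The `i`-th coordinate of a tangent vector at `x` with respect to the preferred chart at `x`. -/
def coord {x : M} (u : TangentSpace (𝓡 4) x) (i : Fin 4) : ℝ :=
  (EuclideanSpace.proj i : EuclideanSpace ℝ (Fin 4) →L[ℝ] ℝ) u

/-- The vector `Γ^k_ij u^i w^j ∂_k` at `x`. -/
def LorentzMetric.christoffelMap (g : LorentzMetric M) (x : M) (u w : TangentSpace (𝓡 4) x) :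
    TangentSpace (𝓡 4) x :=
  ∑ k, (∑ i, ∑ j, g.christoffel x k i j * coord u i * coord w j) • coordField x k x

variable {H : Type*} [TopologicalSpace H] [ChartedSpace (EuclideanHalfSpace 3) H]
  [IsManifold (𝓡∂ 3) ∞ H]

/-- The vector `X(V^k) ∂_k` at `F p`, where `V^k` are the components, in the preferred chart of `M`
at `F p`, of a vector field `V` along a map `F : H → M`. -/
def componentDeriv (F : H → M) (V : ∀ q : H, TangentSpace (𝓡 4) (F q)) (p : H)
    (X : TangentSpace (𝓡∂ 3) p) : TangentSpace (𝓡 4) (F p) :=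
  mfderiv (𝓡∂ 3) 𝓘(ℝ, EuclideanSpace ℝ (Fin 4))
    (fun q ↦ (trivializationAt (EuclideanSpace ℝ (Fin 4)) (TangentSpace (𝓡 4)) (F p)
      (⟨F q, V q⟩ : TangentBundle (𝓡 4) M)).2) p X

/-- The Levi-Civita covariant derivative `D_X V = (X(V^k) + Γ^k_ij (dF X)^i V^j) ∂_k` at `p` of a
vector field `V` along a map `F : H → M` in the direction `X ∈ T_p H`. -/
def covDeriv (g : LorentzMetric M) (F : H → M) (V : ∀ q : H, TangentSpace (𝓡 4) (F q)) (p : H)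
    (X : TangentSpace (𝓡∂ 3) p) : TangentSpace (𝓡 4) (F p) :=
  componentDeriv F V p X + g.christoffelMap (F p) (mfderiv (𝓡∂ 3) (𝓡 4) F p X) (V p)

/-- The derivative `X f` of a function `f` on `H`. -/
def dirDeriv (f : H → ℝ) (p : H) (X : TangentSpace (𝓡∂ 3) p) : ℝ :=
  mfderiv (𝓡∂ 3) 𝓘(ℝ, ℝ) f p X

/-- `X` is tangent to the leaf through `p` of the foliation by the level sets of `v`. -/
def IsLeafTangent (v : H → ℝ) {p : H} (X : TangentSpace (𝓡∂ 3) p) : Prop :=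
  dirDeriv v p X = 0

end Connection

/-- A null hypersurface `H` of `(M, g)` emanating from `S = {s = 1}`, together with its null
geodesic generator `L` and the affine parameter `s`. The hypersurface is a 3-manifold, possibly
with boundary, immersed in `M`; it is null because its normal `L` is tangent to it. -/
structure NullHypersurface {M : Type*} [TopologicalSpace M]
    [ChartedSpace (EuclideanSpace ℝ (Fin 4)) M] [IsManifold (𝓡 4) ∞ M] (g : LorentzMetric M)
    (H : Type*) [TopologicalSpace H] [ChartedSpace (EuclideanHalfSpace 3) H]
    [IsManifold (𝓡∂ 3) ∞ H] where
  /-- The immersion of the hypersurface. -/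
  incl : H → M
  incl_smooth : ContMDiff (𝓡∂ 3) (𝓡 4) ∞ incl
  incl_immersion : ∀ p, Function.Injective (mfderiv (𝓡∂ 3) (𝓡 4) incl p)
  /-- The null generator. -/
  L : ∀ p : H, TangentSpace (𝓡∂ 3) p
  L_smooth : ContMDiff (𝓡∂ 3) (𝓡∂ 3).tangent ∞ (fun p ↦ (⟨p, L p⟩ : TangentBundle (𝓡∂ 3) H))
  L_normal : ∀ (p : H) (X : TangentSpace (𝓡∂ 3) p),
    g.form (incl p) (mfderiv (𝓡∂ 3) (𝓡 4) incl p (L p)) (mfderiv (𝓡∂ 3) (𝓡 4) incl p X) = 0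
  L_geodesic : ∀ p : H,
    covDeriv g incl (fun q ↦ mfderiv (𝓡∂ 3) (𝓡 4) incl q (L q)) p (L p) = 0
  /-- The affine parameter. -/
  s : H → ℝ
  s_smooth : ContMDiff (𝓡∂ 3) 𝓘(ℝ, ℝ) ∞ s
  L_s : ∀ p : H, mfderiv (𝓡∂ 3) 𝓘(ℝ, ℝ) s p (L p) = (1 : ℝ)
  one_le_s : ∀ p : H, 1 ≤ s p
  /-- Every point is reached from `S = {s = 1}` along an integral curve of `L`. -/
  emanates : ∀ p : H, ∃ γ : ℝ → H, s (γ 1) = 1 ∧ γ (s p) = p ∧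
    IsMIntegralCurveOn (I := 𝓡∂ 3) γ L (Set.Icc 1 (s p))

namespace NullHypersurface

variable {M : Type*} [TopologicalSpace M] [ChartedSpace (EuclideanSpace ℝ (Fin 4)) M]
  [IsManifold (𝓡 4) ∞ M] {g : LorentzMetric M}
  {H : Type*} [TopologicalSpace H] [ChartedSpace (EuclideanHalfSpace 3) H]
  [IsManifold (𝓡∂ 3) ∞ H] (N : NullHypersurface g H)

/-- A vector tangent to `H`, seen as a vector of the ambient space. -/
def push {p : H} (X : TangentSpace (𝓡∂ 3) p) : TangentSpace (𝓡 4) (N.incl p) :=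
  mfderiv (𝓡∂ 3) (𝓡 4) N.incl p X

/-- `g(u, w)` for ambient vectors at a point of `H`. -/
def inner (p : H) (u w : TangentSpace (𝓡 4) (N.incl p)) : ℝ := g.form (N.incl p) u w

/-- `D_X V` for a vector field `V` of `M` along `H` and `X` tangent to `H`. -/
def D (V : ∀ q : H, TangentSpace (𝓡 4) (N.incl q)) (p : H) (X : TangentSpace (𝓡∂ 3) p) :
    TangentSpace (𝓡 4) (N.incl p) :=
  covDeriv g N.incl V p X

/-- `v` is a foliation function on `H`: its level sets are the leaves `S_v`, its null lapse
`Ω = L v` is positive, and `v = 1` on `S = {s = 1}`. -/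
structure IsFoliation (v : H → ℝ) : Prop where
  smooth : ContMDiff (𝓡∂ 3) 𝓘(ℝ, ℝ) ∞ v
  lapse_pos : ∀ p : H, 0 < dirDeriv v p (N.L p)
  initial : ∀ p : H, N.s p = 1 → v p = 1

/-- The orthogonal projection of an ambient vector onto the tangent space of the leaf, of which
`(e_1, e_2)` is an orthonormal basis. -/
def proj (e : Fin 2 → ∀ p : H, TangentSpace (𝓡∂ 3) p) (p : H)
    (w : TangentSpace (𝓡 4) (N.incl p)) : TangentSpace (𝓡∂ 3) p :=
  ∑ A, N.inner p w (N.push (e A p)) • e A p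

/-- The induced derivative of a leaf-tangent vector field `Y`: the projection of `D_X Y` onto the
tangent space of the leaf. -/
def slashD (e : Fin 2 → ∀ p : H, TangentSpace (𝓡∂ 3) p)
    (Y : ∀ p : H, TangentSpace (𝓡∂ 3) p) (p : H) (X : TangentSpace (𝓡∂ 3) p) :
    TangentSpace (𝓡∂ 3) p :=
  N.proj e p (N.D (fun q ↦ N.push (Y q)) p X)

/-- The induced derivative `(∇̸_X θ)(Y)` of a leaf-tangent 1-form `θ`: it is linear in the
leaf-tangent vector `Y` and `(∇̸_X θ)(e_B) = X(θ(e_B)) - θ(∇̸_X e_B)`. Both `X` tangent to the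
leaf and `X = L` are used. -/
def slashDForm (e : Fin 2 → ∀ p : H, TangentSpace (𝓡∂ 3) p)
    (θ : ∀ p : H, TangentSpace (𝓡∂ 3) p → ℝ) (p : H) (X Y : TangentSpace (𝓡∂ 3) p) : ℝ :=
  ∑ B, N.inner p (N.push Y) (N.push (e B p)) *
    (dirDeriv (fun q ↦ θ q (e B q)) p X - θ p (N.slashD e (e B) p X))

/-- `(L, Lbar, e_1, e_2)` is, on the open set `U`, a smooth Fermi propagated orthonormal null frame
for the foliation by the level sets of `v`. -/
structure IsFermiNullFrame (v : H → ℝ) (Lbar : ∀ p : H, TangentSpace (𝓡 4) (N.incl p))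
    (e : Fin 2 → ∀ p : H, TangentSpace (𝓡∂ 3) p) (U : Set H) : Prop where
  Lbar_smooth : ContMDiffOn (𝓡∂ 3) (𝓡 4).tangent ∞
    (fun p ↦ (⟨N.incl p, Lbar p⟩ : TangentBundle (𝓡 4) M)) U
  Lbar_null : ∀ p ∈ U, N.inner p (Lbar p) (Lbar p) = 0
  Lbar_L : ∀ p ∈ U, N.inner p (Lbar p) (N.push (N.L p)) = -2
  Lbar_orthogonal : ∀ p ∈ U, ∀ X : TangentSpace (𝓡∂ 3) p, IsLeafTangent v X →
    N.inner p (Lbar p) (N.push X) = 0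
  e_smooth : ∀ A, ContMDiffOn (𝓡∂ 3) (𝓡∂ 3).tangent ∞
    (fun p ↦ (⟨p, e A p⟩ : TangentBundle (𝓡∂ 3) H)) U
  e_tangent : ∀ A, ∀ p ∈ U, IsLeafTangent v (e A p)
  e_orthonormal : ∀ A B, ∀ p ∈ U,
    N.inner p (N.push (e A p)) (N.push (e B p)) = if A = B then 1 else 0
  fermi : ∀ A, ∀ p ∈ U, N.slashD e (e A) p (N.L p) = 0

/-- `U` contains, with each of its points, the generators of `H` from `S` to that point. -/
def IsGeneratorSaturated (U : Set H) : Prop :=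
  ∀ (γ : ℝ → H) (a : ℝ), 1 ≤ a → N.s (γ 1) = 1 →
    IsMIntegralCurveOn (I := 𝓡∂ 3) γ N.L (Set.Icc 1 a) → γ a ∈ U → ∀ t ∈ Set.Icc 1 a, γ t ∈ U

/-! The null connection coefficients, to be evaluated on vectors tangent to the leaves. The
foliation enters through `Lbar` and through the vectors on which they are evaluated. -/

/-- `χ(X, Y) = g(D_X L, Y)`. -/
def chi (p : H) (X Y : TangentSpace (𝓡∂ 3) p) : ℝ :=
  N.inner p (N.D (fun q ↦ N.push (N.L q)) p X) (N.push Y)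

/-- `χbar(X, Y) = g(D_X Lbar, Y)`. -/
def chibar (Lbar : ∀ p : H, TangentSpace (𝓡 4) (N.incl p)) (p : H)
    (X Y : TangentSpace (𝓡∂ 3) p) : ℝ :=
  N.inner p (N.D Lbar p X) (N.push Y)

/-- `ζ(X) = ½ g(D_X L, Lbar)`. -/
def zeta (Lbar : ∀ p : H, TangentSpace (𝓡 4) (N.incl p)) (p : H)
    (X : TangentSpace (𝓡∂ 3) p) : ℝ :=
  (1 / 2) * N.inner p (N.D (fun q ↦ N.push (N.L q)) p X) (Lbar p)

/-- `ηbar(X) = ½ g(D_L Lbar, X)`. -/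
def etabar (Lbar : ∀ p : H, TangentSpace (𝓡 4) (N.incl p)) (p : H)
    (X : TangentSpace (𝓡∂ 3) p) : ℝ :=
  (1 / 2) * N.inner p (N.D Lbar p (N.L p)) (N.push X)

/-- The 1-form `Υ = ∇̸ s` on the leaves: the derivative of `s` along leaf-tangent vectors. -/
def Upsilon (p : H) (X : TangentSpace (𝓡∂ 3) p) : ℝ := dirDeriv N.s p X

/-- `|Υ|²`. -/
def UpsilonSq (e : Fin 2 → ∀ p : H, TangentSpace (𝓡∂ 3) p) (p : H) : ℝ :=
  ∑ A, N.Upsilon p (e A p) ^ 2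

/-- The projection `φ^†` of a 1-tensor: the 1-tensor tangent to the leaves framed by `e` with
`φ^†(e_A) = φ(e'_A)`. -/
def dagger₁ (e e' : Fin 2 → ∀ p : H, TangentSpace (𝓡∂ 3) p)
    (φ : ∀ p : H, TangentSpace (𝓡∂ 3) p → ℝ) (p : H) (X : TangentSpace (𝓡∂ 3) p) : ℝ :=
  ∑ A, N.inner p (N.push X) (N.push (e A p)) * φ p (e' A p)

/-- The projection `φ^†` of a 2-tensor: the 2-tensor tangent to the leaves framed by `e` with
`φ^†(e_A, e_B) = φ(e'_A, e'_B)`. -/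
def dagger₂ (e e' : Fin 2 → ∀ p : H, TangentSpace (𝓡∂ 3) p)
    (φ : ∀ p : H, TangentSpace (𝓡∂ 3) p → TangentSpace (𝓡∂ 3) p → ℝ) (p : H)
    (X Y : TangentSpace (𝓡∂ 3) p) : ℝ :=
  ∑ A, ∑ B, N.inner p (N.push X) (N.push (e A p)) * N.inner p (N.push Y) (N.push (e B p)) *
    φ p (e' A p) (e' B p)

end NullHypersurface

end NullGeometry

end

/-! Everything follows from comparing the two null frames. Since `L` is geodesic and orthogonal to
`H`, Fermi propagation makes both `D_L e_A` and `D_L e'_B` orthogonal to `H`: their leaf components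
vanish by hypothesis, their products with `L` because `g(e_A, L) = 0` and `D_L L = 0`. Hence `g(e_A,
e'_B)` is constant along each generator and keeps its value `δ_AB` from `S` (`inner_e_e'`).
Expanding `e_A` in the geodesic frame, where `L s = 1`, gives `e_A = e'_A + Υ_A L` (`e_eq`).
Orthogonality to `e_A`, nullity and the normalization then force `Lbar = Lbar' + 2 Υ_A e'_A + |Υ|²
L` (`Lbar_eq`).

The four identities come from substituting these two formulas. In `χ` and `ζ` the extra terms are
controlled by `D_L L = 0` and `g(D_X L, L) = 0`. For `ηbar` and `χbar`, differentiating `g(Lbar,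
e_B) = 0` moves the derivative onto `e_B`; thus only `e_B = e'_B + Υ_B L` has to be differentiated,
and the formula for `Lbar` is merely inserted.

The connection being defined through Christoffel symbols, its metric compatibility (`dirDeriv_form`)
and Leibniz rule (`covDeriv_add_smul`) are derived from coordinates beforehand. -/

noncomputable section

namespace NullGeometry

set_option linter.unusedSectionVars false

/-! ### The metric in coordinates and its Christoffel symbols. -/

section Metric

variable {M : Type*} [TopologicalSpace M] [ChartedSpace (EuclideanSpace ℝ (Fin 4)) M]
  [IsManifold (𝓡 4) ∞ M]

/-- The components of a tangent vector at `x` in the preferred chart at `x₀`. -/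
def chartComponents (x₀ x : M) (u : TangentSpace (𝓡 4) x) : EuclideanSpace ℝ (Fin 4) :=
  (trivializationAt (EuclideanSpace ℝ (Fin 4)) (TangentSpace (𝓡 4)) x₀
    (⟨x, u⟩ : TangentBundle (𝓡 4) M)).2

/-- The coordinate change from a chart to itself is the identity at its base point. This reconciles
`coord`, which reads `u` directly as an element of the model space, with components taken in the
trivialization. -/
theorem chartComponents_self (x : M) (u : TangentSpace (𝓡 4) x) :
    chartComponents x x u = u := by
  have h := TangentBundle.continuousLinearMapAt_trivializationAt_eq_core (𝕜 := ℝ) (I := 𝓡 4)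
    (mem_chart_source (EuclideanSpace ℝ (Fin 4)) x)
  have h2 := (tangentBundleCore (𝓡 4) M).coordChange_self (achart _ x) x (mem_chart_source _ x) u
  have h3 := congrArg (fun f ↦ f u) h
  have h4 := (trivializationAt (EuclideanSpace ℝ (Fin 4)) (TangentSpace (𝓡 4))
    x).coe_linearMapAt_of_mem (R := ℝ) (mem_baseSet_trivializationAt _ _ x)
  have h5 := congrFun h4 u
  exact h5.symm.trans (h3.trans h2)

theorem chartComponents_self_apply (x : M) (u : TangentSpace (𝓡 4) x) (i : Fin 4) :
    chartComponents x x u i = coord u i := by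
  rw [chartComponents_self]
  rfl

theorem coordField_self (x : M) (i : Fin 4) :
    coordField x i x = (EuclideanSpace.single i (1 : ℝ) : EuclideanSpace ℝ (Fin 4)) := by
  have h := TangentBundle.symmL_trivializationAt_eq_core (𝕜 := ℝ) (I := 𝓡 4)
    (mem_chart_source (EuclideanSpace ℝ (Fin 4)) x)
  exact (congrArg (fun f ↦ f (EuclideanSpace.single i (1 : ℝ))) h).trans
    ((tangentBundleCore (𝓡 4) M).coordChange_self (achart _ x) x (mem_chart_source _ x) _)

theorem coord_zero (x : M) (i : Fin 4) : coord (0 : TangentSpace (𝓡 4) x) i = 0 :=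
  map_zero (EuclideanSpace.proj i : EuclideanSpace ℝ (Fin 4) →L[ℝ] ℝ)

theorem coord_add {x : M} (u w : TangentSpace (𝓡 4) x) (i : Fin 4) :
    coord (u + w) i = coord u i + coord w i :=
  map_add (EuclideanSpace.proj i : EuclideanSpace ℝ (Fin 4) →L[ℝ] ℝ) u w

theorem coord_smul {x : M} (c : ℝ) (u : TangentSpace (𝓡 4) x) (i : Fin 4) :
    coord (c • u) i = c * coord u i :=
  map_smul (EuclideanSpace.proj i : EuclideanSpace ℝ (Fin 4) →L[ℝ] ℝ) c u

theorem coord_sum_smul {x : M} (c : Fin 4 → ℝ) (u : Fin 4 → TangentSpace (𝓡 4) x) (j : Fin 4) :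
    coord (∑ i, c i • u i) j = ∑ i, c i * coord (u i) j := by
  simp only [Fin.sum_univ_four, coord_add, coord_smul]

theorem coord_coordField_self (x : M) (i j : Fin 4) :
    coord (coordField x i x) j = if j = i then 1 else 0 := by
  rw [coordField_self]
  simp [coord]

theorem chartComponents_add {x₀ x : M}
    (hx : x ∈ (trivializationAt (EuclideanSpace ℝ (Fin 4)) (TangentSpace (𝓡 4)) x₀).baseSet)
    (u w : TangentSpace (𝓡 4) x) :
    chartComponents x₀ x (u + w) = chartComponents x₀ x u + chartComponents x₀ x w :=
  ((trivializationAt (EuclideanSpace ℝ (Fin 4)) (TangentSpace (𝓡 4)) x₀).linear ℝ hx).map_add u w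

theorem chartComponents_smul {x₀ x : M}
    (hx : x ∈ (trivializationAt (EuclideanSpace ℝ (Fin 4)) (TangentSpace (𝓡 4)) x₀).baseSet)
    (c : ℝ) (u : TangentSpace (𝓡 4) x) :
    chartComponents x₀ x (c • u) = c • chartComponents x₀ x u :=
  ((trivializationAt (EuclideanSpace ℝ (Fin 4)) (TangentSpace (𝓡 4)) x₀).linear ℝ hx).map_smul c u

theorem eq_sum_coordField {x₀ x : M}
    (hx : x ∈ (trivializationAt (EuclideanSpace ℝ (Fin 4)) (TangentSpace (𝓡 4)) x₀).baseSet)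
    (u : TangentSpace (𝓡 4) x) :
    u = ∑ i, chartComponents x₀ x u i • coordField x₀ i x := by
  set φ := trivializationAt (EuclideanSpace ℝ (Fin 4)) (TangentSpace (𝓡 4)) x₀
  have h1 : φ.symmL ℝ x (chartComponents x₀ x u) = u := by
    have h := φ.symmL_continuousLinearMapAt (R := ℝ) hx u
    have h4 := congrFun (φ.coe_linearMapAt_of_mem (R := ℝ) hx) u
    rw [φ.continuousLinearMapAt_apply ℝ, h4] at h
    exact h
  have h2 : chartComponents x₀ x u =
      ∑ i, chartComponents x₀ x u i • EuclideanSpace.single i (1 : ℝ) := by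
    ext j
    simp [Finset.sum_apply, Pi.single_apply]
  conv_lhs => rw [← h1, h2, map_sum]
  simp only [map_smul]
  rfl

theorem eq_sum_coord (x : M) (u : TangentSpace (𝓡 4) x) :
    u = ∑ i, coord u i • coordField x i x := by
  have h := eq_sum_coordField
    (mem_baseSet_trivializationAt (EuclideanSpace ℝ (Fin 4)) (TangentSpace (𝓡 4)) x) u
  rw [chartComponents_self] at h
  exact h

namespace LorentzMetric

variable (g : LorentzMetric M)

theorem component_symm (x₀ : M) (i j : Fin 4) : g.component x₀ i j = g.component x₀ j i :=
  funext fun x ↦ g.symm x _ _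

theorem dComponent_symm (x₀ : M) (k i j : Fin 4) :
    g.dComponent x₀ k i j = g.dComponent x₀ k j i := by
  unfold dComponent
  rw [g.component_symm x₀ i j]

theorem form_eq_sum {x₀ x : M}
    (hx : x ∈ (trivializationAt (EuclideanSpace ℝ (Fin 4)) (TangentSpace (𝓡 4)) x₀).baseSet)
    (u w : TangentSpace (𝓡 4) x) :
    g.form x u w = ∑ i, ∑ j, g.component x₀ i j x *
      (chartComponents x₀ x u i * chartComponents x₀ x w j) := by
  conv_lhs => rw [eq_sum_coordField hx u, eq_sum_coordField hx w]
  simp only [map_sum, map_smul, sum_apply, smul_apply,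
    smul_eq_mul, Finset.mul_sum, component]
  rw [Finset.sum_comm]
  refine Finset.sum_congr rfl fun i _ ↦ Finset.sum_congr rfl fun j _ ↦ by ring

theorem form_eq_sum_coord (x : M) (u w : TangentSpace (𝓡 4) x) :
    g.form x u w = ∑ i, ∑ j, g.component x i j x * (coord u i * coord w j) := by
  have h := g.form_eq_sum
    (mem_baseSet_trivializationAt (EuclideanSpace ℝ (Fin 4)) (TangentSpace (𝓡 4)) x) u w
  rw [chartComponents_self, chartComponents_self] at h
  exact h

theorem nondegenerate (x : M) (u : TangentSpace (𝓡 4) x) (hu : ∀ w, g.form x u w = 0) : u = 0 := by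
  obtain ⟨b, hb⟩ := g.signature x
  rw [← b.sum_repr u]
  refine Finset.sum_eq_zero fun i _ ↦ ?_
  have h := hu (b i)
  rw [← b.sum_repr u] at h
  simp only [map_sum, map_smul, sum_apply, smul_apply,
    hb, smul_eq_mul, mul_ite, mul_zero, Finset.sum_ite_eq', Finset.mem_univ, if_true] at h
  have h' : b.repr u i = 0 := by
    split_ifs at h <;> simpa using h
  rw [h', zero_smul]

/-- A kernel vector of the Gram matrix would be the coordinate vector of something orthogonal to all
of the tangent space. Invertibility ensures that the matrix inverse inside `christoffel` is a
genuine inverse and not the default value. -/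
theorem isUnit_det_component (x : M) :
    IsUnit (Matrix.of fun a b ↦ g.component x a b x).det := by
  rw [isUnit_iff_ne_zero]
  intro hdet
  obtain ⟨c, hc, hc0⟩ := Matrix.exists_mulVec_eq_zero_iff.2 hdet
  refine hc ?_
  have hu : (∑ i, c i • coordField x i x) = 0 := by
    refine g.nondegenerate x _ fun w ↦ ?_
    rw [eq_sum_coord x w, g.symm]
    simp only [map_sum, map_smul, sum_apply, smul_apply, Finset.smul_sum]
    rw [Finset.sum_comm]
    refine Finset.sum_eq_zero fun j _ ↦ ?_
    have h := congrFun hc0 j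
    simp only [Matrix.mulVec, dotProduct, Matrix.of_apply, Pi.zero_apply, component] at h
    simp only [smul_eq_mul, mul_left_comm (c _), ← Finset.mul_sum]
    simp only [mul_comm (c _), h, mul_zero]
  funext j
  have h := congrArg (fun u ↦ coord u j) hu
  simpa only [coord_sum_smul, coord_coordField_self, coord_zero, mul_ite, mul_one, mul_zero,
    Finset.sum_ite_eq, Finset.mem_univ, if_true, Pi.zero_apply] using h

/-- The Christoffel symbols with lowered index. -/
theorem sum_component_mul_christoffel (x : M) (m i j : Fin 4) :
    ∑ k, g.component x m k x * g.christoffel x k i j =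
      (1 / 2) * (g.dComponent x i j m + g.dComponent x j i m - g.dComponent x m i j) := by
  have h := Matrix.mul_nonsing_inv _ (g.isUnit_det_component x)
  simp only [christoffel, Finset.mul_sum]
  rw [Finset.sum_comm]
  have h' : ∀ l, ∑ k, g.component x m k x * (Matrix.of fun a b ↦ g.component x a b x)⁻¹ k l =
      if m = l then 1 else 0 := fun l ↦ by
    simpa [Matrix.mul_apply, Matrix.one_apply] using congrFun (congrFun h m) l
  calc _ = ∑ l, (1 / 2) * (∑ k, g.component x m k x *
        (Matrix.of fun a b ↦ g.component x a b x)⁻¹ k l) *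
        (g.dComponent x i j l + g.dComponent x j i l - g.dComponent x l i j) := by
        refine Finset.sum_congr rfl fun l _ ↦ ?_
        rw [Finset.mul_sum, Finset.sum_mul]
        exact Finset.sum_congr rfl fun k _ ↦ by ring
    _ = _ := by simp [h']

/-- Pairing with `z` lowers the upper index, so the inverse metric disappears and only first
derivatives of the components remain. -/
theorem form_christoffelMap (x : M) (u w z : TangentSpace (𝓡 4) x) :
    g.form x z (g.christoffelMap x u w) = ∑ k, ∑ i, ∑ j, (1 / 2) *
      (g.dComponent x k i j + g.dComponent x i k j - g.dComponent x j k i) *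
      (coord u k * coord w i * coord z j) := by
  have h : g.form x z (g.christoffelMap x u w) = ∑ l, (∑ k, ∑ i, g.christoffel x l k i *
      coord u k * coord w i) * ∑ j, coord z j * g.component x j l x := by
    conv_lhs => rw [eq_sum_coord x z]
    simp only [christoffelMap, map_sum, map_smul, sum_apply,
      smul_apply, smul_eq_mul, component]
  rw [h]
  simp only [Finset.sum_mul]
  simp only [Finset.mul_sum]
  rw [Finset.sum_comm]
  refine Finset.sum_congr rfl fun k _ ↦ ?_
  rw [Finset.sum_comm]
  refine Finset.sum_congr rfl fun i _ ↦ ?_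
  rw [Finset.sum_comm]
  refine Finset.sum_congr rfl fun j _ ↦ ?_
  rw [← g.sum_component_mul_christoffel x j k i, Finset.sum_mul]
  exact Finset.sum_congr rfl fun l _ ↦ by ring

/-- The Christoffel symbols are compatible with the metric. -/
theorem form_christoffelMap_add (x : M) (u w z : TangentSpace (𝓡 4) x) :
    g.form x (g.christoffelMap x u w) z + g.form x w (g.christoffelMap x u z) =
      ∑ i, ∑ j, (∑ k, coord u k * g.dComponent x k i j) * (coord w i * coord z j) := by
  rw [g.symm x _ z, form_christoffelMap, form_christoffelMap]
  have h₁ : ∀ f : Fin 4 → Fin 4 → Fin 4 → ℝ, ∑ k, ∑ i, ∑ j, f k i j = ∑ i, ∑ j, ∑ k, f k i j :=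
    fun f ↦ by
      rw [Finset.sum_comm]
      exact Finset.sum_congr rfl fun i _ ↦ Finset.sum_comm
  have h₂ : ∀ f : Fin 4 → Fin 4 → Fin 4 → ℝ, ∑ k, ∑ j, ∑ i, f k j i = ∑ i, ∑ j, ∑ k, f k j i :=
    fun f ↦ by rw [h₁, Finset.sum_comm]
  refine (congrArg₂ (· + ·) (h₁ _) (h₂ _)).trans ?_
  simp only [← Finset.sum_add_distrib, Finset.sum_mul]
  refine Finset.sum_congr rfl fun i _ ↦ Finset.sum_congr rfl fun j _ ↦
    Finset.sum_congr rfl fun k _ ↦ ?_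
  -- After alignment by symmetry, the `∂_i` and `∂_j` terms of the two Christoffel expressions
  -- cancel and the two halves of `∂_k g_ij` add up.
  rw [g.dComponent_symm x k j i, g.dComponent_symm x i k j, g.dComponent_symm x j k i]
  ring

/-- In the trivialization at `x₀` the coordinate fields are constant, hence smooth, and the metric
is a smooth section evaluated on them. -/
theorem contMDiffAt_component (x₀ : M) (i j : Fin 4) :
    ContMDiffAt (𝓡 4) 𝓘(ℝ, ℝ) ∞ (g.component x₀ i j) x₀ := by
  set φ := trivializationAt (EuclideanSpace ℝ (Fin 4)) (TangentSpace (𝓡 4) : M → Type _) x₀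
  have hx := mem_baseSet_trivializationAt (EuclideanSpace ℝ (Fin 4))
    (TangentSpace (𝓡 4) : M → Type _) x₀
  have hc : ∀ i, ContMDiffAt (𝓡 4) ((𝓡 4).prod 𝓘(ℝ, EuclideanSpace ℝ (Fin 4))) ∞
      (fun x ↦ (⟨x, coordField x₀ i x⟩ : TangentBundle (𝓡 4) M)) x₀ := fun i ↦ by
    rw [Bundle.contMDiffAt_section]
    refine (contMDiffAt_const (c := EuclideanSpace.single i (1 : ℝ))).congr_of_eventuallyEq ?_
    filter_upwards [φ.open_baseSet.mem_nhds hx] with x hx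
    have h := φ.continuousLinearMapAt_symmL (R := ℝ) hx (EuclideanSpace.single i (1 : ℝ))
    rw [φ.continuousLinearMapAt_apply ℝ, φ.coe_linearMapAt_of_mem (R := ℝ) hx] at h
    exact h
  have h := ContMDiffAt.clm_bundle_apply₂ (F₁ := EuclideanSpace ℝ (Fin 4))
    (F₂ := EuclideanSpace ℝ (Fin 4)) (F₃ := ℝ) (E₃ := Bundle.Trivial M ℝ) (b := id)
    (g.smooth x₀) (hc i) (hc j)
  exact ((Bundle.contMDiffAt_section _).1 h)

end LorentzMetric

end Metric

/-! ### The covariant derivative along a map: metric compatibility and Leibniz rule. -/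

section Connection

variable {M : Type*} [TopologicalSpace M] [ChartedSpace (EuclideanSpace ℝ (Fin 4)) M]
  [IsManifold (𝓡 4) ∞ M]
  {H : Type*} [TopologicalSpace H] [ChartedSpace (EuclideanHalfSpace 3) H]
  [IsManifold (𝓡∂ 3) ∞ H]

theorem HasMFDerivAt.dirDeriv_eq {f : H → ℝ} {p : H} {f' : TangentSpace (𝓡∂ 3) p →L[ℝ] ℝ}
    (h : HasMFDerivAt (𝓡∂ 3) 𝓘(ℝ, ℝ) f p f') (X : TangentSpace (𝓡∂ 3) p) :
    dirDeriv f p X = f' X := by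
  unfold dirDeriv
  rw [h.mfderiv]
  rfl

theorem dirDeriv_add {f₁ f₂ : H → ℝ} {p : H} (h₁ : MDifferentiableAt (𝓡∂ 3) 𝓘(ℝ, ℝ) f₁ p)
    (h₂ : MDifferentiableAt (𝓡∂ 3) 𝓘(ℝ, ℝ) f₂ p) (X : TangentSpace (𝓡∂ 3) p) :
    dirDeriv (fun q ↦ f₁ q + f₂ q) p X = dirDeriv f₁ p X + dirDeriv f₂ p X :=
  HasMFDerivAt.dirDeriv_eq (h₁.hasMFDerivAt.add h₂.hasMFDerivAt) X

theorem mdifferentiableAt_fun_mul {f₁ f₂ : H → ℝ} {p : H}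
    (h₁ : MDifferentiableAt (𝓡∂ 3) 𝓘(ℝ, ℝ) f₁ p) (h₂ : MDifferentiableAt (𝓡∂ 3) 𝓘(ℝ, ℝ) f₂ p) :
    MDifferentiableAt (𝓡∂ 3) 𝓘(ℝ, ℝ) (fun q ↦ f₁ q * f₂ q) p :=
  h₁.mul h₂

theorem dirDeriv_mul {f₁ f₂ : H → ℝ} {p : H} (h₁ : MDifferentiableAt (𝓡∂ 3) 𝓘(ℝ, ℝ) f₁ p)
    (h₂ : MDifferentiableAt (𝓡∂ 3) 𝓘(ℝ, ℝ) f₂ p) (X : TangentSpace (𝓡∂ 3) p) :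
    dirDeriv (fun q ↦ f₁ q * f₂ q) p X = dirDeriv f₁ p X * f₂ p + f₁ p * dirDeriv f₂ p X := by
  refine (HasMFDerivAt.dirDeriv_eq (h₁.hasMFDerivAt.mul h₂.hasMFDerivAt) X).trans ?_
  change f₁ p * dirDeriv f₂ p X + f₂ p * dirDeriv f₁ p X = _
  ring

theorem mdifferentiableAt_fun_sum {ι : Type} (t : Finset ι) {f : ι → H → ℝ} {p : H}
    (h : ∀ i ∈ t, MDifferentiableAt (𝓡∂ 3) 𝓘(ℝ, ℝ) (f i) p) :
    MDifferentiableAt (𝓡∂ 3) 𝓘(ℝ, ℝ) (fun q ↦ ∑ i ∈ t, f i q) p := by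
  have e : (fun q ↦ ∑ i ∈ t, f i q) = ∑ i ∈ t, f i := by ext; simp
  rw [e]
  exact MDifferentiableAt.sum h

theorem dirDeriv_sum {ι : Type} (t : Finset ι) {f : ι → H → ℝ} {p : H}
    (h : ∀ i ∈ t, MDifferentiableAt (𝓡∂ 3) 𝓘(ℝ, ℝ) (f i) p) (X : TangentSpace (𝓡∂ 3) p) :
    dirDeriv (fun q ↦ ∑ i ∈ t, f i q) p X = ∑ i ∈ t, dirDeriv (f i) p X := by
  have e : (fun q ↦ ∑ i ∈ t, f i q) = ∑ i ∈ t, f i := by ext; simp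
  rw [e]
  refine (HasMFDerivAt.dirDeriv_eq (HasMFDerivAt.sum fun i hi ↦ (h i hi).hasMFDerivAt) X).trans ?_
  exact sum_apply (F := TangentSpace (𝓡∂ 3) p →L[ℝ] ℝ) t
    (fun i ↦ mfderiv (𝓡∂ 3) 𝓘(ℝ, ℝ) (f i) p) X

theorem dirDeriv_congr {f₁ f₂ : H → ℝ} {p : H} (h : f₁ =ᶠ[nhds p] f₂)
    (X : TangentSpace (𝓡∂ 3) p) : dirDeriv f₁ p X = dirDeriv f₂ p X := by
  unfold dirDeriv
  rw [h.mfderiv_eq]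
  rfl

theorem dirDeriv_const (c : ℝ) (p : H) (X : TangentSpace (𝓡∂ 3) p) :
    dirDeriv (fun _ ↦ c) p X = 0 := by
  unfold dirDeriv
  rw [mfderiv_const]
  rfl

theorem dirDeriv_add_right (f : H → ℝ) (p : H) (X Y : TangentSpace (𝓡∂ 3) p) :
    dirDeriv f p (X + Y) = dirDeriv f p X + dirDeriv f p Y :=
  map_add (mfderiv (𝓡∂ 3) 𝓘(ℝ, ℝ) f p) X Y

theorem dirDeriv_smul_right (f : H → ℝ) (p : H) (c : ℝ) (X : TangentSpace (𝓡∂ 3) p) :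
    dirDeriv f p (c • X) = c * dirDeriv f p X :=
  map_smul (mfderiv (𝓡∂ 3) 𝓘(ℝ, ℝ) f p) c X

/-- The vector field `V` along `F` is differentiable at `p`. -/
def DifferentiableAlong (F : H → M) (V : ∀ q : H, TangentSpace (𝓡 4) (F q)) (p : H) : Prop :=
  MDifferentiableAt (𝓡∂ 3) 𝓘(ℝ, EuclideanSpace ℝ (Fin 4))
    (fun q ↦ chartComponents (F p) (F q) (V q)) p

variable {F : H → M} {V W : ∀ q : H, TangentSpace (𝓡 4) (F q)} {p : H}

theorem differentiableAlong_of_contMDiffAt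
    (h : ContMDiffAt (𝓡∂ 3) (𝓡 4).tangent ∞
      (fun q ↦ (⟨F q, V q⟩ : TangentBundle (𝓡 4) M)) p) :
    DifferentiableAlong F V p :=
  (Bundle.contMDiffAt_totalSpace.1 h).2.mdifferentiableAt (by simp)

theorem eventually_mem_baseSet (hF : ContinuousAt F p) :
    ∀ᶠ q in nhds p, F q ∈
      (trivializationAt (EuclideanSpace ℝ (Fin 4)) (TangentSpace (𝓡 4)) (F p)).baseSet :=
  hF.eventually ((trivializationAt (EuclideanSpace ℝ (Fin 4)) (TangentSpace (𝓡 4))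
    (F p)).open_baseSet.mem_nhds (mem_baseSet_trivializationAt _ _ _))

theorem DifferentiableAlong.hasMFDerivAt_component (h : DifferentiableAlong F V p) (i : Fin 4) :
    HasMFDerivAt (𝓡∂ 3) 𝓘(ℝ, ℝ) (fun q ↦ chartComponents (F p) (F q) (V q) i) p
      ((EuclideanSpace.proj i : EuclideanSpace ℝ (Fin 4) →L[ℝ] ℝ).comp
        (mfderiv (𝓡∂ 3) 𝓘(ℝ, EuclideanSpace ℝ (Fin 4))
          (fun q ↦ chartComponents (F p) (F q) (V q)) p)) :=
  (EuclideanSpace.proj i : EuclideanSpace ℝ (Fin 4) →L[ℝ] ℝ).hasMFDerivAt.comp p h.hasMFDerivAt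

theorem coord_componentDeriv (h : DifferentiableAlong F V p) (X : TangentSpace (𝓡∂ 3) p)
    (i : Fin 4) : coord (componentDeriv F V p X) i =
      dirDeriv (fun q ↦ chartComponents (F p) (F q) (V q) i) p X :=
  (HasMFDerivAt.dirDeriv_eq (h.hasMFDerivAt_component i) X).symm

theorem mdifferentiableAt_component_comp (g : LorentzMetric M)
    (hF : MDifferentiableAt (𝓡∂ 3) (𝓡 4) F p) (i j : Fin 4) :
    MDifferentiableAt (𝓡∂ 3) 𝓘(ℝ, ℝ) (fun q ↦ g.component (F p) i j (F q)) p :=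
  MDifferentiableAt.comp p ((g.contMDiffAt_component (F p) i j).mdifferentiableAt (by simp)) hF

theorem dirDeriv_component_comp (g : LorentzMetric M)
    (hF : MDifferentiableAt (𝓡∂ 3) (𝓡 4) F p) (i j : Fin 4) (X : TangentSpace (𝓡∂ 3) p) :
    dirDeriv (fun q ↦ g.component (F p) i j (F q)) p X =
      ∑ k, coord (mfderiv (𝓡∂ 3) (𝓡 4) F p X) k * g.dComponent (F p) k i j := by
  have hg := (g.contMDiffAt_component (F p) i j).mdifferentiableAt (by simp)
  refine (HasMFDerivAt.dirDeriv_eq (hg.hasMFDerivAt.comp p hF.hasMFDerivAt) X).trans ?_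
  change mfderiv (𝓡 4) 𝓘(ℝ, ℝ) (g.component (F p) i j) (F p) (mfderiv (𝓡∂ 3) (𝓡 4) F p X) = _
  conv_lhs => rw [eq_sum_coord (F p) (mfderiv (𝓡∂ 3) (𝓡 4) F p X)]
  rw [map_sum]
  refine Finset.sum_congr rfl fun k _ ↦ ?_
  rw [map_smul]
  rfl

theorem form_eventuallyEq (g : LorentzMetric M) (hF : ContinuousAt F p) :
    (fun q ↦ g.form (F q) (V q) (W q)) =ᶠ[nhds p] fun q ↦ ∑ i, ∑ j,
      g.component (F p) i j (F q) * (chartComponents (F p) (F q) (V q) i *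
        chartComponents (F p) (F q) (W q) j) := by
  filter_upwards [eventually_mem_baseSet hF] with q hq using g.form_eq_sum hq _ _

theorem DifferentiableAlong.mdifferentiableAt_form (g : LorentzMetric M)
    (hF : MDifferentiableAt (𝓡∂ 3) (𝓡 4) F p) (hV : DifferentiableAlong F V p)
    (hW : DifferentiableAlong F W p) :
    MDifferentiableAt (𝓡∂ 3) 𝓘(ℝ, ℝ) (fun q ↦ g.form (F q) (V q) (W q)) p := by
  refine MDifferentiableAt.congr_of_eventuallyEq ?_ (form_eventuallyEq g hF.continuousAt)
  exact mdifferentiableAt_fun_sum _ fun i _ ↦ mdifferentiableAt_fun_sum _ fun j _ ↦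
    (mdifferentiableAt_component_comp g hF i j).mul
      ((hV.hasMFDerivAt_component i).mdifferentiableAt.mul
        (hW.hasMFDerivAt_component j).mdifferentiableAt)

/-- The Levi-Civita connection is compatible with the metric. -/
theorem dirDeriv_form (g : LorentzMetric M)
    (hF : MDifferentiableAt (𝓡∂ 3) (𝓡 4) F p) (hV : DifferentiableAlong F V p)
    (hW : DifferentiableAlong F W p) (X : TangentSpace (𝓡∂ 3) p) :
    dirDeriv (fun q ↦ g.form (F q) (V q) (W q)) p X =
      g.form (F p) (covDeriv g F V p X) (W p) + g.form (F p) (V p) (covDeriv g F W p X) := by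
  have hc := mdifferentiableAt_component_comp g hF
  have hV' := fun i ↦ (hV.hasMFDerivAt_component i).mdifferentiableAt
  have hW' := fun i ↦ (hW.hasMFDerivAt_component i).mdifferentiableAt
  rw [dirDeriv_congr (form_eventuallyEq g hF.continuousAt)]
  have hd : ∀ i j, MDifferentiableAt (𝓡∂ 3) 𝓘(ℝ, ℝ) (fun q ↦ g.component (F p) i j (F q) *
      (chartComponents (F p) (F q) (V q) i * chartComponents (F p) (F q) (W q) j)) p :=
    fun i j ↦ (hc i j).mul ((hV' i).mul (hW' j))
  rw [dirDeriv_sum _ fun i _ ↦ mdifferentiableAt_fun_sum _ fun j _ ↦ hd i j]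
  -- Product rule for `g_ij V^i W^j` in the chart at `F p`; the terms with derivatives of `g_ij` are
  -- the ones that the Christoffel parts of the two covariant derivatives supply.
  have h : ∀ i j, dirDeriv (fun q ↦ g.component (F p) i j (F q) *
      (chartComponents (F p) (F q) (V q) i * chartComponents (F p) (F q) (W q) j)) p X =
      (∑ k, coord (mfderiv (𝓡∂ 3) (𝓡 4) F p X) k * g.dComponent (F p) k i j) *
        (coord (V p) i * coord (W p) j) +
      g.component (F p) i j (F p) * (coord (componentDeriv F V p X) i * coord (W p) j) +
      g.component (F p) i j (F p) * (coord (V p) i * coord (componentDeriv F W p X) j) := by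
    intro i j
    rw [dirDeriv_mul (hc i j) (mdifferentiableAt_fun_mul (hV' i) (hW' j)),
      dirDeriv_mul (hV' i) (hW' j),
      dirDeriv_component_comp g hF, ← coord_componentDeriv hV, ← coord_componentDeriv hW,
      chartComponents_self_apply, chartComponents_self_apply]
    ring
  simp only [covDeriv, map_add, add_apply]
  rw [add_add_add_comm, g.form_christoffelMap_add, g.form_eq_sum_coord (F p) _ (W p),
    g.form_eq_sum_coord (F p) (V p)]
  simp only [← Finset.sum_add_distrib]
  refine Finset.sum_congr rfl fun i _ ↦ ?_
  rw [dirDeriv_sum _ fun j _ ↦ hd i j]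
  refine Finset.sum_congr rfl fun j _ ↦ ?_
  rw [h]
  ring

theorem christoffelMap_add_left (g : LorentzMetric M) (x : M) (u u' w : TangentSpace (𝓡 4) x) :
    g.christoffelMap x (u + u') w = g.christoffelMap x u w + g.christoffelMap x u' w := by
  simp only [LorentzMetric.christoffelMap, coord_add, mul_add, add_mul, Finset.sum_add_distrib,
    add_smul]

theorem christoffelMap_smul_left (g : LorentzMetric M) (x : M) (c : ℝ)
    (u w : TangentSpace (𝓡 4) x) :
    g.christoffelMap x (c • u) w = c • g.christoffelMap x u w := by
  simp only [LorentzMetric.christoffelMap, coord_smul, Finset.smul_sum, smul_smul, Finset.mul_sum]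
  congr! 4
  ring

theorem christoffelMap_add_right (g : LorentzMetric M) (x : M) (u w w' : TangentSpace (𝓡 4) x) :
    g.christoffelMap x u (w + w') = g.christoffelMap x u w + g.christoffelMap x u w' := by
  simp only [LorentzMetric.christoffelMap, coord_add, mul_add, Finset.sum_add_distrib,
    add_smul]

theorem christoffelMap_smul_right (g : LorentzMetric M) (x : M) (c : ℝ)
    (u w : TangentSpace (𝓡 4) x) :
    g.christoffelMap x u (c • w) = c • g.christoffelMap x u w := by
  simp only [LorentzMetric.christoffelMap, coord_smul, Finset.smul_sum, smul_smul, Finset.mul_sum]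
  congr! 4
  ring

theorem covDeriv_add_right (g : LorentzMetric M) (F : H → M)
    (V : ∀ q : H, TangentSpace (𝓡 4) (F q)) (p : H) (X Y : TangentSpace (𝓡∂ 3) p) :
    covDeriv g F V p (X + Y) = covDeriv g F V p X + covDeriv g F V p Y := by
  simp only [covDeriv, componentDeriv, map_add, christoffelMap_add_left]
  exact add_add_add_comm _ _ _ _

theorem covDeriv_smul_right (g : LorentzMetric M) (F : H → M)
    (V : ∀ q : H, TangentSpace (𝓡 4) (F q)) (p : H) (c : ℝ) (X : TangentSpace (𝓡∂ 3) p) :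
    covDeriv g F V p (c • X) = c • covDeriv g F V p X := by
  simp only [covDeriv, componentDeriv, map_smul, christoffelMap_smul_left]
  exact (smul_add c _ _).symm

theorem covDeriv_congr (g : LorentzMetric M) (h : ∀ᶠ q in nhds p, V q = W q)
    (X : TangentSpace (𝓡∂ 3) p) : covDeriv g F V p X = covDeriv g F W p X := by
  have h' : (fun q ↦ (trivializationAt (EuclideanSpace ℝ (Fin 4)) (TangentSpace (𝓡 4)) (F p)
      (⟨F q, V q⟩ : TangentBundle (𝓡 4) M)).2) =ᶠ[nhds p]
      (fun q ↦ (trivializationAt (EuclideanSpace ℝ (Fin 4)) (TangentSpace (𝓡 4)) (F p)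
      (⟨F q, W q⟩ : TangentBundle (𝓡 4) M)).2) := by
    filter_upwards [h] with q hq
    rw [hq]
  simp only [covDeriv, componentDeriv, h'.mfderiv_eq, h.self_of_nhds]
  rfl

/-- The Leibniz rule for the covariant derivative of `V + f W`. -/
theorem covDeriv_add_smul (g : LorentzMetric M) {f : H → ℝ}
    (hF : ContinuousAt F p) (hV : DifferentiableAlong F V p)
    (hW : DifferentiableAlong F W p) (hf : MDifferentiableAt (𝓡∂ 3) 𝓘(ℝ, ℝ) f p)
    (X : TangentSpace (𝓡∂ 3) p) :
    covDeriv g F (fun q ↦ V q + f q • W q) p X =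
      covDeriv g F V p X + dirDeriv f p X • W p + f p • covDeriv g F W p X := by
  have hVW : DifferentiableAlong F (fun q ↦ V q + f q • W q) p := by
    refine (MDifferentiableAt.add hV (MDifferentiableAt.smul hf hW)).congr_of_eventuallyEq ?_
    filter_upwards [eventually_mem_baseSet hF] with q hq
    rw [chartComponents_add hq, chartComponents_smul hq]
    rfl
  have h : componentDeriv F (fun q ↦ V q + f q • W q) p X =
      componentDeriv F V p X + dirDeriv f p X • W p + f p • componentDeriv F W p X := by
    rw [eq_sum_coord (F p) (componentDeriv F (fun q ↦ V q + f q • W q) p X),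
      eq_sum_coord (F p) (_ + _)]
    refine Finset.sum_congr rfl fun i _ ↦ ?_
    congr 1
    rw [coord_add, coord_add, coord_smul, coord_smul, coord_componentDeriv hVW,
      coord_componentDeriv hV, coord_componentDeriv hW]
    have hVi := (hV.hasMFDerivAt_component i).mdifferentiableAt
    have hWi := (hW.hasMFDerivAt_component i).mdifferentiableAt
    have he : (fun q ↦ chartComponents (F p) (F q) (V q + f q • W q) i) =ᶠ[nhds p]
        fun q ↦ chartComponents (F p) (F q) (V q) i +
          f q * chartComponents (F p) (F q) (W q) i := by
      filter_upwards [eventually_mem_baseSet hF] with q hq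
      rw [chartComponents_add hq, chartComponents_smul hq]
      rfl
    rw [dirDeriv_congr he, dirDeriv_add hVi (mdifferentiableAt_fun_mul hf hWi), add_assoc]
    congr 1
    refine (dirDeriv_mul hf hWi X).trans ?_
    rw [chartComponents_self]
    rfl
  simp only [covDeriv, h, christoffelMap_add_right, christoffelMap_smul_right, smul_add]
  abel

end Connection

/-! ### Calculus of scalar products along the null hypersurface. -/

namespace NullHypersurface

variable {M : Type*} [TopologicalSpace M] [ChartedSpace (EuclideanSpace ℝ (Fin 4)) M]
  [IsManifold (𝓡 4) ∞ M] {g : LorentzMetric M}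
  {H : Type*} [TopologicalSpace H] [ChartedSpace (EuclideanHalfSpace 3) H]
  [IsManifold (𝓡∂ 3) ∞ H] (N : NullHypersurface g H)

theorem push_add {p : H} (X Y : TangentSpace (𝓡∂ 3) p) : N.push (X + Y) = N.push X + N.push Y :=
  map_add (mfderiv (𝓡∂ 3) (𝓡 4) N.incl p) X Y

theorem push_smul {p : H} (c : ℝ) (X : TangentSpace (𝓡∂ 3) p) : N.push (c • X) = c • N.push X :=
  map_smul (mfderiv (𝓡∂ 3) (𝓡 4) N.incl p) c X

theorem push_zero (p : H) : N.push (0 : TangentSpace (𝓡∂ 3) p) = 0 :=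
  map_zero (mfderiv (𝓡∂ 3) (𝓡 4) N.incl p)

theorem inner_comm (p : H) (u w : TangentSpace (𝓡 4) (N.incl p)) :
    N.inner p u w = N.inner p w u :=
  g.symm _ u w

theorem inner_add_left (p : H) (u u' w : TangentSpace (𝓡 4) (N.incl p)) :
    N.inner p (u + u') w = N.inner p u w + N.inner p u' w := by
  simp [inner]

theorem inner_smul_left (p : H) (c : ℝ) (u w : TangentSpace (𝓡 4) (N.incl p)) :
    N.inner p (c • u) w = c * N.inner p u w := by
  simp [inner]

theorem inner_zero_left (p : H) (w : TangentSpace (𝓡 4) (N.incl p)) :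
    N.inner p 0 w = 0 := by
  simp [inner]

theorem inner_add_right (p : H) (u w w' : TangentSpace (𝓡 4) (N.incl p)) :
    N.inner p u (w + w') = N.inner p u w + N.inner p u w' := by
  simp [inner]

theorem inner_smul_right (p : H) (c : ℝ) (u w : TangentSpace (𝓡 4) (N.incl p)) :
    N.inner p u (c • w) = c * N.inner p u w := by
  simp [inner]

theorem inner_zero_right (p : H) (u : TangentSpace (𝓡 4) (N.incl p)) :
    N.inner p u 0 = 0 := by
  simp [inner]

theorem inner_L_push {p : H} (X : TangentSpace (𝓡∂ 3) p) :
    N.inner p (N.push (N.L p)) (N.push X) = 0 :=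
  N.L_normal p X

theorem inner_push_L {p : H} (X : TangentSpace (𝓡∂ 3) p) :
    N.inner p (N.push X) (N.push (N.L p)) = 0 := by
  rw [inner_comm, inner_L_push]

theorem dirDeriv_s_L (p : H) : dirDeriv N.s p (N.L p) = 1 := N.L_s p

theorem D_L_L (p : H) : N.D (fun q ↦ N.push (N.L q)) p (N.L p) = 0 := N.L_geodesic p

theorem mdifferentiableAt_incl (p : H) : MDifferentiableAt (𝓡∂ 3) (𝓡 4) N.incl p :=
  (N.incl_smooth p).mdifferentiableAt (by simp)

theorem differentiableAlong_push {Y : ∀ p : H, TangentSpace (𝓡∂ 3) p} {p : H}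
    (h : ContMDiffAt (𝓡∂ 3) (𝓡∂ 3).tangent ∞ (fun q ↦ (⟨q, Y q⟩ : TangentBundle (𝓡∂ 3) H)) p) :
    DifferentiableAlong N.incl (fun q ↦ N.push (Y q)) p :=
  differentiableAlong_of_contMDiffAt
    (((N.incl_smooth.contMDiff_tangentMap (m := ∞) (by simp)).contMDiffAt).comp p h)

theorem differentiableAlong_push_L (p : H) :
    DifferentiableAlong N.incl (fun q ↦ N.push (N.L q)) p :=
  N.differentiableAlong_push (N.L_smooth p)

variable {V W : ∀ q : H, TangentSpace (𝓡 4) (N.incl q)} {p : H}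

theorem mdifferentiableAt_inner (hV : DifferentiableAlong N.incl V p)
    (hW : DifferentiableAlong N.incl W p) :
    MDifferentiableAt (𝓡∂ 3) 𝓘(ℝ, ℝ) (fun q ↦ N.inner q (V q) (W q)) p :=
  hV.mdifferentiableAt_form g (N.mdifferentiableAt_incl p) hW

theorem dirDeriv_inner (hV : DifferentiableAlong N.incl V p)
    (hW : DifferentiableAlong N.incl W p) (X : TangentSpace (𝓡∂ 3) p) :
    dirDeriv (fun q ↦ N.inner q (V q) (W q)) p X =
      N.inner p (N.D V p X) (W p) + N.inner p (V p) (N.D W p X) :=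
  dirDeriv_form g (N.mdifferentiableAt_incl p) hV hW X

/-- The tool for moving a derivative from one factor of a frame relation, such as `g(Lbar, e_A) =
0`, to the other. -/
theorem inner_D_of_eventually_const (hV : DifferentiableAlong N.incl V p)
    (hW : DifferentiableAlong N.incl W p) {c : ℝ}
    (h : ∀ᶠ q in nhds p, N.inner q (V q) (W q) = c) (X : TangentSpace (𝓡∂ 3) p) :
    N.inner p (N.D V p X) (W p) = - N.inner p (V p) (N.D W p X) := by
  have h1 := N.dirDeriv_inner hV hW X
  rw [dirDeriv_congr (f₂ := fun _ ↦ c) h, dirDeriv_const] at h1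
  linarith

theorem D_add_right (V : ∀ q : H, TangentSpace (𝓡 4) (N.incl q)) (p : H)
    (X Y : TangentSpace (𝓡∂ 3) p) : N.D V p (X + Y) = N.D V p X + N.D V p Y :=
  covDeriv_add_right g N.incl V p X Y

theorem D_smul_right (V : ∀ q : H, TangentSpace (𝓡 4) (N.incl q)) (p : H) (c : ℝ)
    (X : TangentSpace (𝓡∂ 3) p) : N.D V p (c • X) = c • N.D V p X :=
  covDeriv_smul_right g N.incl V p c X

/-- `D_X L` is tangent to `H`. -/
theorem inner_D_L_L (X : TangentSpace (𝓡∂ 3) p) :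
    N.inner p (N.D (fun q ↦ N.push (N.L q)) p X) (N.push (N.L p)) = 0 := by
  -- As `g(L, L) = 0`, the quantity `g(D_X L, L)` equals its own negative.
  have h := N.inner_D_of_eventually_const (N.differentiableAlong_push_L p)
    (N.differentiableAlong_push_L p) (c := 0)
    (Filter.Eventually.of_forall fun q ↦ N.inner_L_push (N.L q)) X
  rw [N.inner_comm p (N.push _)] at h
  linarith

/-! ### Expansions in a null frame and transport along generators. -/

namespace IsFermiNullFrame

variable {N} {v : H → ℝ} {Lbar : ∀ p : H, TangentSpace (𝓡 4) (N.incl p)}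
  {e : Fin 2 → ∀ p : H, TangentSpace (𝓡∂ 3) p} {U : Set H}

theorem differentiableAlong_e (h : N.IsFermiNullFrame v Lbar e U) (hU : IsOpen U) (hp : p ∈ U)
    (A : Fin 2) : DifferentiableAlong N.incl (fun q ↦ N.push (e A q)) p :=
  N.differentiableAlong_push ((h.e_smooth A).contMDiffAt (hU.mem_nhds hp))

theorem differentiableAlong_Lbar (h : N.IsFermiNullFrame v Lbar e U) (hU : IsOpen U)
    (hp : p ∈ U) : DifferentiableAlong N.incl Lbar p :=
  differentiableAlong_of_contMDiffAt (h.Lbar_smooth.contMDiffAt (hU.mem_nhds hp))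

/-- The decomposition of a vector tangent to `H` into its leaf-tangent part and its part
along `L`. -/
theorem eq_sum_add_smul_L (h : N.IsFermiNullFrame v Lbar e U) (hp : p ∈ U)
    (hv : dirDeriv v p (N.L p) ≠ 0) (X : TangentSpace (𝓡∂ 3) p) :
    X = ∑ A, N.inner p (N.push X) (N.push (e A p)) • e A p +
      (dirDeriv v p X / dirDeriv v p (N.L p)) • N.L p := by
  have he : ∀ A, dirDeriv v p (e A p) = 0 := fun A ↦ h.e_tangent A p hp
  have ho : ∀ A B, N.inner p (N.push (e A p)) (N.push (e B p)) = if A = B then 1 else 0 :=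
    fun A B ↦ h.e_orthonormal A B p hp
  -- Scalar products recover the coefficients of the `e_A` but cannot see `L`, which is orthogonal
  -- to all of `H`. The coefficient of `L` is detected by `v`, since `e_A v = 0` and `L v ≠ 0`.
  have hli : LinearIndependent ℝ ![e 0 p, e 1 p, N.L p] := by
    rw [Fintype.linearIndependent_iff]
    intro c hc
    simp only [Fin.sum_univ_three, Matrix.cons_val] at hc
    have h0 : ∀ A, N.inner p (N.push (c 0 • e 0 p + c 1 • e 1 p + c 2 • N.L p))
        (N.push (e A p)) = 0 := fun A ↦ by
      rw [hc, push_zero, inner_zero_left]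
    have h1 : dirDeriv v p (c 0 • e 0 p + c 1 • e 1 p + c 2 • N.L p) = 0 := by
      rw [hc]
      simpa using dirDeriv_smul_right v p 0 0
    simp only [push_add, push_smul, inner_add_left, inner_smul_left, ho, inner_L_push] at h0
    simp only [dirDeriv_add_right, dirDeriv_smul_right, he] at h1
    intro i
    fin_cases i
    · simpa using h0 0
    · simpa using h0 1
    · simpa [hv] using h1
  have : FiniteDimensional ℝ (TangentSpace (𝓡∂ 3) p) :=
    inferInstanceAs (FiniteDimensional ℝ (EuclideanSpace ℝ (Fin 3)))
  have hspan := hli.span_eq_top_of_card_eq_finrank' (by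
    change _ = Module.finrank ℝ (EuclideanSpace ℝ (Fin 3))
    simp)
  obtain ⟨c, hc⟩ := (Submodule.mem_span_range_iff_exists_fun ℝ).1
    (hspan ▸ Submodule.mem_top : X ∈ Submodule.span ℝ (Set.range ![e 0 p, e 1 p, N.L p]))
  simp only [Fin.sum_univ_three, Matrix.cons_val] at hc
  rw [← hc]
  simp only [Fin.sum_univ_two, push_add, push_smul, inner_add_left, inner_smul_left, ho,
    inner_L_push, dirDeriv_add_right, dirDeriv_smul_right, he]
  congr 2 <;> simp [hv]

theorem eq_sum_of_isLeafTangent (h : N.IsFermiNullFrame v Lbar e U) (hp : p ∈ U)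
    (hv : dirDeriv v p (N.L p) ≠ 0) {X : TangentSpace (𝓡∂ 3) p} (hX : IsLeafTangent v X) :
    X = ∑ A, N.inner p (N.push X) (N.push (e A p)) • e A p := by
  have h1 := h.eq_sum_add_smul_L hp hv X
  rw [show dirDeriv v p X = 0 from hX, zero_div, zero_smul, add_zero] at h1
  exact h1

/-- The decomposition of an ambient vector in a null frame. -/
theorem eq_sum_add_smul_add_smul (h : N.IsFermiNullFrame v Lbar e U) (hp : p ∈ U)
    (w : TangentSpace (𝓡 4) (N.incl p)) :
    w = ∑ A, N.inner p w (N.push (e A p)) • N.push (e A p) +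
      (-(1 / 2) * N.inner p w (Lbar p)) • N.push (N.L p) +
      (-(1 / 2) * N.inner p w (N.push (N.L p))) • Lbar p := by
  have ho : ∀ A B, N.inner p (N.push (e A p)) (N.push (e B p)) = if A = B then 1 else 0 :=
    fun A B ↦ h.e_orthonormal A B p hp
  have hb : ∀ A, N.inner p (Lbar p) (N.push (e A p)) = 0 :=
    fun A ↦ h.Lbar_orthogonal p hp _ (h.e_tangent A p hp)
  have hb' : ∀ A, N.inner p (N.push (e A p)) (Lbar p) = 0 := fun A ↦ by rw [inner_comm, hb]
  have hL := h.Lbar_L p hp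
  have hL' : N.inner p (N.push (N.L p)) (Lbar p) = -2 := by rw [inner_comm, hL]
  have hn := h.Lbar_null p hp
  have hli : LinearIndependent ℝ ![N.push (e 0 p), N.push (e 1 p), N.push (N.L p), Lbar p] := by
    rw [Fintype.linearIndependent_iff]
    intro c hc
    simp only [Fin.sum_univ_four, Matrix.cons_val] at hc
    have hz : ∀ w, N.inner p (c 0 • N.push (e 0 p) + c 1 • N.push (e 1 p) +
        c 2 • N.push (N.L p) + c 3 • Lbar p) w = 0 := fun w ↦ by
      rw [hc, inner_zero_left]
    simp only [inner_add_left, inner_smul_left] at hz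
    -- In a null frame the coefficient of `L` is read off by pairing with `Lbar`, and that of `Lbar`
    -- by pairing with `L`.
    have h0 := hz (N.push (e 0 p))
    have h1 := hz (N.push (e 1 p))
    have h2 := hz (Lbar p)
    have h3 := hz (N.push (N.L p))
    simp only [ho, hb, hb', hL, hL', hn, inner_L_push, inner_push_L] at h0 h1 h2 h3
    intro i
    fin_cases i
    · simpa using h0
    · simpa using h1
    · simpa using h2
    · simpa using h3
  have : FiniteDimensional ℝ (TangentSpace (𝓡 4) (N.incl p)) :=
    inferInstanceAs (FiniteDimensional ℝ (EuclideanSpace ℝ (Fin 4)))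
  have hspan := hli.span_eq_top_of_card_eq_finrank' (by
    change _ = Module.finrank ℝ (EuclideanSpace ℝ (Fin 4))
    simp)
  obtain ⟨c, hc⟩ := (Submodule.mem_span_range_iff_exists_fun ℝ).1
    (hspan ▸ Submodule.mem_top : w ∈ Submodule.span ℝ
      (Set.range ![N.push (e 0 p), N.push (e 1 p), N.push (N.L p), Lbar p]))
  simp only [Fin.sum_univ_four, Matrix.cons_val] at hc
  rw [← hc]
  simp only [Fin.sum_univ_two, inner_add_left, inner_smul_left, ho, hb, hb', hL, hL', hn,
    inner_L_push, inner_push_L]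
  congr 2
  · congr 2 <;> simp
  · congr 1
    ring
  · ring

/-- `D_L e_A` is orthogonal to `H`. -/
theorem inner_D_e_L (h : N.IsFermiNullFrame v Lbar e U) (hU : IsOpen U) (hp : p ∈ U)
    (hv : dirDeriv v p (N.L p) ≠ 0) (A : Fin 2) (X : TangentSpace (𝓡∂ 3) p) :
    N.inner p (N.D (fun q ↦ N.push (e A q)) p (N.L p)) (N.push X) = 0 := by
  have ho : ∀ A B, N.inner p (N.push (e A p)) (N.push (e B p)) = if A = B then 1 else 0 :=
    fun A B ↦ h.e_orthonormal A B p hp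
  have he : ∀ B, N.inner p (N.D (fun q ↦ N.push (e A q)) p (N.L p)) (N.push (e B p)) = 0 := by
    have hf := h.fermi A p hp
    simp only [slashD, proj, Fin.sum_univ_two] at hf
    have hz : ∀ B, N.inner p (N.push (0 : TangentSpace (𝓡∂ 3) p)) (N.push (e B p)) = 0 :=
      fun B ↦ by rw [push_zero, inner_zero_left]
    rw [← hf] at hz
    simp only [push_add, push_smul, inner_add_left, inner_smul_left, ho] at hz
    intro B
    fin_cases B
    · simpa using hz 0
    · simpa using hz 1
  -- The Fermi condition controls only the leaf components; the `L` direction uses that `L` is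
  -- geodesic.
  have hL : N.inner p (N.D (fun q ↦ N.push (e A q)) p (N.L p)) (N.push (N.L p)) = 0 := by
    rw [N.inner_D_of_eventually_const (h.differentiableAlong_e hU hp A)
      (N.differentiableAlong_push_L p) (c := 0)
      (Filter.Eventually.of_forall fun q ↦ N.inner_push_L _), D_L_L, inner_zero_right, neg_zero]
  rw [h.eq_sum_add_smul_L hp hv X]
  simp only [Fin.sum_univ_two, push_add, push_smul, inner_add_right, inner_smul_right, he, hL]
  ring

end IsFermiNullFrame

theorem eq_of_dirDeriv_L_eq_zero {f : H → ℝ} {γ : ℝ → H} {a b : ℝ} (hab : a ≤ b)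
    (hγ : IsMIntegralCurveOn (I := 𝓡∂ 3) γ N.L (Set.Icc a b))
    (hf : ∀ t ∈ Set.Icc a b, MDifferentiableAt (𝓡∂ 3) 𝓘(ℝ, ℝ) f (γ t))
    (hf' : ∀ t ∈ Set.Icc a b, dirDeriv f (γ t) (N.L (γ t)) = 0) : f (γ b) = f (γ a) := by
  have hd : ∀ t ∈ Set.Icc a b, HasDerivWithinAt (fun t ↦ f (γ t)) 0 (Set.Icc a b) t := by
    intro t ht
    rw [hasDerivWithinAt_iff_hasFDerivWithinAt]
    refine HasFDerivWithinAt.congr_fderiv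
      ((hf t ht).hasMFDerivAt.comp_hasMFDerivWithinAt t (hγ t ht)).hasFDerivWithinAt
      (ContinuousLinearMap.ext_ring ?_)
    refine Eq.trans ?_ ((hf' t ht).trans (by simp; rfl))
    change mfderiv (𝓡∂ 3) 𝓘(ℝ, ℝ) f (γ t) ((1 : ℝ) • N.L (γ t)) = _
    rw [one_smul]
    rfl
  -- The curve is differentiable only within the closed interval, so constancy is drawn from right
  -- derivatives.
  refine constant_of_has_deriv_right_zero (fun t ht ↦ (hd t ht).continuousWithinAt)
    (fun t ht ↦ ?_) b ⟨hab, le_rfl⟩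
  exact (hd t ⟨ht.1, ht.2.le⟩).mono_of_mem_nhdsWithin (Icc_mem_nhdsGE_of_mem ht)

end NullHypersurface

/-! ### Multilinearity: reduction of the identities to frame components. -/

namespace NullHypersurface

variable {M : Type*} [TopologicalSpace M] [ChartedSpace (EuclideanSpace ℝ (Fin 4)) M]
  [IsManifold (𝓡 4) ∞ M] {g : LorentzMetric M}
  {H : Type*} [TopologicalSpace H] [ChartedSpace (EuclideanHalfSpace 3) H]
  [IsManifold (𝓡∂ 3) ∞ H] {N : NullHypersurface g H}

theorem chi_eq_sum (N : NullHypersurface g H)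
    (p : H) {X Y : TangentSpace (𝓡∂ 3) p}
    {b : Fin 2 → TangentSpace (𝓡∂ 3) p}
    {x y : Fin 2 → ℝ} (hX : X = ∑ A, x A • b A) (hY : Y = ∑ A, y A • b A) :
    N.chi p X Y = ∑ A, ∑ B, x A * y B * N.chi p (b A) (b B) := by
  subst hX hY
  simp only [chi, Fin.sum_univ_two, push_add, push_smul, D_add_right, D_smul_right,
    inner_add_left, inner_smul_left, inner_add_right, inner_smul_right]
  ring

theorem chibar_eq_sum (N : NullHypersurface g H)
    (Lbar : ∀ p : H, TangentSpace (𝓡 4) (N.incl p)) (p : H)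
    {X Y : TangentSpace (𝓡∂ 3) p} {b : Fin 2 → TangentSpace (𝓡∂ 3) p}
    {x y : Fin 2 → ℝ} (hX : X = ∑ A, x A • b A) (hY : Y = ∑ A, y A • b A) :
    N.chibar Lbar p X Y = ∑ A, ∑ B, x A * y B * N.chibar Lbar p (b A) (b B) := by
  subst hX hY
  simp only [chibar, Fin.sum_univ_two, push_add, push_smul, D_add_right, D_smul_right,
    inner_add_left, inner_smul_left, inner_add_right, inner_smul_right]
  ring

theorem zeta_eq_sum (N : NullHypersurface g H)
    (Lbar : ∀ p : H, TangentSpace (𝓡 4) (N.incl p)) (p : H)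
    {X : TangentSpace (𝓡∂ 3) p} {b : Fin 2 → TangentSpace (𝓡∂ 3) p}
    {x : Fin 2 → ℝ} (hX : X = ∑ A, x A • b A) :
    N.zeta Lbar p X = ∑ A, x A * N.zeta Lbar p (b A) := by
  subst hX
  simp only [zeta, Fin.sum_univ_two, D_add_right, D_smul_right, inner_add_left, inner_smul_left]
  ring

theorem etabar_eq_sum (N : NullHypersurface g H)
    (Lbar : ∀ p : H, TangentSpace (𝓡 4) (N.incl p)) (p : H)
    {X : TangentSpace (𝓡∂ 3) p} {b : Fin 2 → TangentSpace (𝓡∂ 3) p}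
    {x : Fin 2 → ℝ} (hX : X = ∑ A, x A • b A) :
    N.etabar Lbar p X = ∑ A, x A * N.etabar Lbar p (b A) := by
  subst hX
  simp only [etabar, Fin.sum_univ_two, push_add, push_smul, inner_add_right, inner_smul_right]
  ring

theorem Upsilon_eq_sum (N : NullHypersurface g H)
    (p : H) {X : TangentSpace (𝓡∂ 3) p}
    {b : Fin 2 → TangentSpace (𝓡∂ 3) p}
    {x : Fin 2 → ℝ} (hX : X = ∑ A, x A • b A) :
    N.Upsilon p X = ∑ A, x A * N.Upsilon p (b A) := by
  subst hX
  simp only [Upsilon, Fin.sum_univ_two, dirDeriv_add_right, dirDeriv_smul_right]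

theorem slashDForm_Upsilon (N : NullHypersurface g H)
    (e : Fin 2 → ∀ p : H, TangentSpace (𝓡∂ 3) p) (p : H)
    (X Y : TangentSpace (𝓡∂ 3) p) :
    N.slashDForm e N.Upsilon p X Y = ∑ B, N.inner p (N.push Y) (N.push (e B p)) *
      (dirDeriv (fun q ↦ N.Upsilon q (e B q)) p X -
        ∑ C, N.inner p (N.D (fun q ↦ N.push (e B q)) p X) (N.push (e C p)) *
          N.Upsilon p (e C p)) := by
  simp only [slashDForm, slashD, proj]
  refine Finset.sum_congr rfl fun B _ ↦ ?_
  rw [N.Upsilon_eq_sum p rfl]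

theorem slashDForm_Upsilon_eq_sum (N : NullHypersurface g H)
    (e : Fin 2 → ∀ p : H, TangentSpace (𝓡∂ 3) p) (p : H)
    {X : TangentSpace (𝓡∂ 3) p} (Y : TangentSpace (𝓡∂ 3) p) {x : Fin 2 → ℝ}
    (hX : X = ∑ A, x A • e A p) :
    N.slashDForm e N.Upsilon p X Y = ∑ A, ∑ B, x A * N.inner p (N.push Y) (N.push (e B p)) *
      (dirDeriv (fun q ↦ N.Upsilon q (e B q)) p (e A p) -
        ∑ C, N.inner p (N.D (fun q ↦ N.push (e B q)) p (e A p)) (N.push (e C p)) *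
          N.Upsilon p (e C p)) := by
  subst hX
  simp only [slashDForm_Upsilon, Fin.sum_univ_two, dirDeriv_add_right, dirDeriv_smul_right,
    D_add_right, D_smul_right, inner_add_left, inner_smul_left]
  ring

/-! ### The change of frame and the transformation of the coefficients. -/

namespace IsFermiNullFrame

variable {v : H → ℝ} {Lbar Lbar' : ∀ p : H, TangentSpace (𝓡 4) (N.incl p)}
  {e e' : Fin 2 → ∀ p : H, TangentSpace (𝓡∂ 3) p} {U : Set H} {p : H}

/-- Two Fermi propagated frames that agree on the initial surface have constant scalar products
along the generators. -/
theorem inner_e_e' (hv : N.IsFoliation v) (hU : IsOpen U) (hUsat : N.IsGeneratorSaturated U)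
    (h : N.IsFermiNullFrame v Lbar e U) (h' : N.IsFermiNullFrame N.s Lbar' e' U)
    (hS : ∀ A, ∀ p ∈ U, N.s p = 1 → e' A p = e A p) (hp : p ∈ U) (A B : Fin 2) :
    N.inner p (N.push (e A p)) (N.push (e' B p)) = if A = B then 1 else 0 := by
  obtain ⟨γ, hγ1, hγp, hγ⟩ := N.emanates p
  have hmem : ∀ t ∈ Set.Icc 1 (N.s p), γ t ∈ U :=
    hUsat γ (N.s p) (N.one_le_s p) hγ1 hγ (hγp.symm ▸ hp)
  have hd : ∀ q ∈ U, MDifferentiableAt (𝓡∂ 3) 𝓘(ℝ, ℝ)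
      (fun q ↦ N.inner q (N.push (e A q)) (N.push (e' B q))) q := fun q hq ↦
    N.mdifferentiableAt_inner (h.differentiableAlong_e hU hq A) (h'.differentiableAlong_e hU hq B)
  have hd' : ∀ q ∈ U, dirDeriv (fun q ↦ N.inner q (N.push (e A q)) (N.push (e' B q))) q
      (N.L q) = 0 := fun q hq ↦ by
    -- Each `L`-derivative is orthogonal to all of `H`, hence also to the other foliation's frame
    -- vectors, although these are not tangent to its own leaves.
    rw [N.dirDeriv_inner (h.differentiableAlong_e hU hq A) (h'.differentiableAlong_e hU hq B),
      h.inner_D_e_L hU hq (hv.lapse_pos q).ne', inner_comm,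
      h'.inner_D_e_L hU hq (by rw [dirDeriv_s_L]; exact one_ne_zero), add_zero]
  have hc := N.eq_of_dirDeriv_L_eq_zero (N.one_le_s p) hγ (fun t ht ↦ hd _ (hmem t ht))
    (fun t ht ↦ hd' _ (hmem t ht))
  have h1 := hmem 1 ⟨le_rfl, N.one_le_s p⟩
  rw [hγp] at hc
  rw [hc, hS B _ h1 hγ1, h.e_orthonormal A B _ h1]

/-- The change of frame `e_A = e'_A + Υ_A L`. -/
theorem e_eq (hv : N.IsFoliation v) (hU : IsOpen U) (hUsat : N.IsGeneratorSaturated U)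
    (h : N.IsFermiNullFrame v Lbar e U) (h' : N.IsFermiNullFrame N.s Lbar' e' U)
    (hS : ∀ A, ∀ p ∈ U, N.s p = 1 → e' A p = e A p) (hp : p ∈ U) (A : Fin 2) :
    e A p = e' A p + N.Upsilon p (e A p) • N.L p := by
  have h1 := h'.eq_sum_add_smul_L hp (by rw [dirDeriv_s_L]; exact one_ne_zero) (e A p)
  rw [dirDeriv_s_L, div_one] at h1
  simp only [inner_e_e' hv hU hUsat h h' hS hp, ite_smul, one_smul, zero_smul,
    Finset.sum_ite_eq, Finset.mem_univ, if_true] at h1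
  exact h1

/-- The change of frame `Lbar = Lbar' + 2 Υ_A e'_A + |Υ|² L`. -/
theorem Lbar_eq (h : N.IsFermiNullFrame v Lbar e U) (h' : N.IsFermiNullFrame N.s Lbar' e' U)
    (hp : p ∈ U) (he : ∀ A, e A p = e' A p + N.Upsilon p (e A p) • N.L p) :
    Lbar p = Lbar' p + (∑ A, (2 * N.Upsilon p (e A p)) • N.push (e' A p)) +
      N.UpsilonSq e p • N.push (N.L p) := by
  have hL := h.Lbar_L p hp
  have hb : ∀ A, N.inner p (Lbar p) (N.push (e' A p)) = 2 * N.Upsilon p (e A p) := fun A ↦ by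
    have h1 := h.Lbar_orthogonal p hp _ (h.e_tangent A p hp)
    rw [he A, push_add, push_smul, inner_add_right, inner_smul_right, hL] at h1
    linarith
  have h1 := h'.eq_sum_add_smul_add_smul hp (Lbar p)
  -- Pairing the expansion of `Lbar` with `Lbar` itself gives `0 = 4 |Υ|² + 2 g(Lbar, Lbar')`.
  have h2 : N.inner p (Lbar p) (Lbar' p) = - 2 * N.UpsilonSq e p := by
    have h3 := congrArg (N.inner p (Lbar p)) h1
    simp only [h.Lbar_null p hp, hL, Fin.sum_univ_two, inner_add_right, inner_smul_right, hb] at h3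
    simp only [UpsilonSq, Fin.sum_univ_two]
    linarith
  rw [h2, hL] at h1
  simp only [hb] at h1
  rw [h1]
  module

/-- Near `p` one has `Υ_A = -½ g(Lbar', e_A)`, so regularity is inherited from the frames and no
second derivative of `s` has to be discussed. -/
theorem mdifferentiableAt_Upsilon (hU : IsOpen U) (h : N.IsFermiNullFrame v Lbar e U)
    (h' : N.IsFermiNullFrame N.s Lbar' e' U)
    (he : ∀ q ∈ U, ∀ A, e A q = e' A q + N.Upsilon q (e A q) • N.L q) (hp : p ∈ U) (A : Fin 2) :
    MDifferentiableAt (𝓡∂ 3) 𝓘(ℝ, ℝ) (fun q ↦ N.Upsilon q (e A q)) p := by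
  have h1 : MDifferentiableAt (𝓡∂ 3) 𝓘(ℝ, ℝ)
      (fun q ↦ (-(1 / 2) : ℝ) * N.inner q (Lbar' q) (N.push (e A q))) p :=
    mdifferentiableAt_fun_mul mdifferentiableAt_const
      (N.mdifferentiableAt_inner (h'.differentiableAlong_Lbar hU hp)
        (h.differentiableAlong_e hU hp A))
  refine h1.congr_of_eventuallyEq ?_
  filter_upwards [hU.mem_nhds hp] with q hq
  have h2 : N.inner q (Lbar' q) (N.push (e A q)) = -2 * N.Upsilon q (e A q) := by
    conv_lhs => rw [he q hq A]
    rw [push_add, push_smul, inner_add_right, inner_smul_right,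
      h'.Lbar_L q hq, h'.Lbar_orthogonal q hq _ (h'.e_tangent A q hq)]
    ring
  rw [h2]
  ring

theorem D_e_eq (hU : IsOpen U) (h : N.IsFermiNullFrame v Lbar e U)
    (h' : N.IsFermiNullFrame N.s Lbar' e' U)
    (he : ∀ q ∈ U, ∀ A, e A q = e' A q + N.Upsilon q (e A q) • N.L q) (hp : p ∈ U) (A : Fin 2)
    (X : TangentSpace (𝓡∂ 3) p) :
    N.D (fun q ↦ N.push (e A q)) p X = N.D (fun q ↦ N.push (e' A q)) p X +
      dirDeriv (fun q ↦ N.Upsilon q (e A q)) p X • N.push (N.L p) +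
      N.Upsilon p (e A p) • N.D (fun q ↦ N.push (N.L q)) p X := by
  refine Eq.trans ?_ (covDeriv_add_smul g (N.mdifferentiableAt_incl p).continuousAt
    (h'.differentiableAlong_e hU hp A) (N.differentiableAlong_push_L p)
    (mdifferentiableAt_Upsilon hU h h' he hp A) X)
  refine covDeriv_congr g ?_ X
  filter_upwards [hU.mem_nhds hp] with q hq
  conv_lhs => rw [he q hq A]
  rw [push_add, push_smul]

theorem D_L_e_eq (he : ∀ A, e A p = e' A p + N.Upsilon p (e A p) • N.L p) (A : Fin 2) :
    N.D (fun q ↦ N.push (N.L q)) p (e A p) = N.D (fun q ↦ N.push (N.L q)) p (e' A p) := by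
  conv_lhs => rw [he A]
  rw [D_add_right, D_smul_right, D_L_L, smul_zero, add_zero]

/-- Modulo `L` the two frames agree, and `L` drops out of both slots: `D_L L = 0` in the first,
`g(D_X L, L) = 0` in the second. -/
theorem chi_e_e (he : ∀ A, e A p = e' A p + N.Upsilon p (e A p) • N.L p) (A B : Fin 2) :
    N.chi p (e A p) (e B p) = N.chi p (e' A p) (e' B p) := by
  unfold chi
  rw [D_L_e_eq he A]
  conv_lhs => rw [he B]
  rw [push_add, push_smul, inner_add_right, inner_smul_right, inner_D_L_L, mul_zero, add_zero]

theorem zeta_e (h : N.IsFermiNullFrame v Lbar e U) (h' : N.IsFermiNullFrame N.s Lbar' e' U)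
    (hp : p ∈ U) (he : ∀ A, e A p = e' A p + N.Upsilon p (e A p) • N.L p) (A : Fin 2) :
    N.zeta Lbar p (e A p) = N.zeta Lbar' p (e' A p) +
      ∑ B, N.chi p (e' A p) (e' B p) * N.Upsilon p (e B p) := by
  unfold zeta
  rw [D_L_e_eq he A, Lbar_eq h h' hp he]
  simp only [Fin.sum_univ_two, inner_add_right, inner_smul_right, inner_D_L_L, chi]
  ring

theorem inner_D_Lbar_e (hU : IsOpen U) (h : N.IsFermiNullFrame v Lbar e U) (hp : p ∈ U)
    (A : Fin 2) (X : TangentSpace (𝓡∂ 3) p) :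
    N.inner p (N.D Lbar p X) (N.push (e A p)) =
      - N.inner p (Lbar p) (N.D (fun q ↦ N.push (e A q)) p X) := by
  refine N.inner_D_of_eventually_const (c := 0) (h.differentiableAlong_Lbar hU hp)
    (h.differentiableAlong_e hU hp A) ?_ X
  filter_upwards [hU.mem_nhds hp] with q hq
  exact h.Lbar_orthogonal q hq _ (h.e_tangent A q hq)

theorem inner_L_D_e (hU : IsOpen U) (h : N.IsFermiNullFrame v Lbar e U) (hp : p ∈ U)
    (A : Fin 2) (X : TangentSpace (𝓡∂ 3) p) :
    N.inner p (N.D (fun q ↦ N.push (e A q)) p X) (N.push (N.L p)) = - N.chi p X (e A p) := by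
  rw [N.inner_D_of_eventually_const (c := 0) (h.differentiableAlong_e hU hp A)
    (N.differentiableAlong_push_L p) (Filter.Eventually.of_forall fun q ↦ N.inner_push_L _) X,
    inner_comm]
  rfl

/-- Since `D_L e_A` is orthogonal to `H`, only the `Lbar'` part of `Lbar` contributes to `g(Lbar,
D_L e_A)`. The new term comes from `D_L e_A = D_L e'_A + L(Υ_A) L` and `g(Lbar', L) = -2`. -/
theorem etabar_e (hv : dirDeriv v p (N.L p) ≠ 0) (hU : IsOpen U)
    (h : N.IsFermiNullFrame v Lbar e U) (h' : N.IsFermiNullFrame N.s Lbar' e' U)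
    (he : ∀ q ∈ U, ∀ A, e A q = e' A q + N.Upsilon q (e A q) • N.L q) (hp : p ∈ U) (A : Fin 2) :
    N.etabar Lbar p (e A p) = N.etabar Lbar' p (e' A p) +
      dirDeriv (fun q ↦ N.Upsilon q (e A q)) p (N.L p) := by
  unfold etabar
  rw [h.inner_D_Lbar_e hU hp, h'.inner_D_Lbar_e hU hp, Lbar_eq h h' hp (he p hp)]
  simp only [Fin.sum_univ_two, inner_add_left, inner_smul_left]
  simp only [N.inner_comm p (N.push _), h.inner_D_e_L hU hp hv]
  rw [D_e_eq hU h h' he hp A, D_L_L]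
  simp only [inner_add_right, inner_smul_right, inner_zero_right, h'.Lbar_L p hp]
  ring

/-- Expresses `∇_A Υ_B` through the connection coefficients of the primed frame, the form in which
they appear in `χbar`. The corrections come from `g(D e'_B, L) = -χ'` and from the `Υ_B D L` part of
`D e_B`. -/
theorem slashDForm_e_e (hU : IsOpen U) (h : N.IsFermiNullFrame v Lbar e U)
    (h' : N.IsFermiNullFrame N.s Lbar' e' U)
    (he : ∀ q ∈ U, ∀ A, e A q = e' A q + N.Upsilon q (e A q) • N.L q) (hp : p ∈ U)
    (A B : Fin 2) :
    dirDeriv (fun q ↦ N.Upsilon q (e B q)) p (e A p) -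
        ∑ C, N.inner p (N.D (fun q ↦ N.push (e B q)) p (e A p)) (N.push (e C p)) *
          N.Upsilon p (e C p) =
      dirDeriv (fun q ↦ N.Upsilon q (e B q)) p (e A p) -
        ∑ C, N.inner p (N.D (fun q ↦ N.push (e' B q)) p (e A p)) (N.push (e' C p)) *
          N.Upsilon p (e C p) + N.UpsilonSq e p * N.chi p (e' A p) (e' B p) -
        N.Upsilon p (e B p) * ∑ C, N.chi p (e' A p) (e' C p) * N.Upsilon p (e C p) := by
  have h1 : ∀ C, N.inner p (N.D (fun q ↦ N.push (e B q)) p (e A p)) (N.push (e C p)) =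
      N.inner p (N.D (fun q ↦ N.push (e' B q)) p (e A p)) (N.push (e' C p)) -
      N.Upsilon p (e C p) * N.chi p (e' A p) (e' B p) +
      N.Upsilon p (e B p) * N.chi p (e' A p) (e' C p) := by
    intro C
    have h2 : N.inner p (N.D (fun q ↦ N.push (N.L q)) p (e A p)) (N.push (e C p)) =
      N.chi p (e' A p) (e' C p) := chi_e_e (he p hp) A C
    have h3 : N.inner p (N.D (fun q ↦ N.push (e' B q)) p (e A p)) (N.push (N.L p)) =
        - N.chi p (e' A p) (e' B p) := by
      rw [h'.inner_L_D_e hU hp]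
      unfold chi
      rw [D_L_e_eq (he p hp)]
    have h4 : N.inner p (N.D (fun q ↦ N.push (e' B q)) p (e A p)) (N.push (e C p)) =
        N.inner p (N.D (fun q ↦ N.push (e' B q)) p (e A p)) (N.push (e' C p)) -
        N.Upsilon p (e C p) * N.chi p (e' A p) (e' B p) := by
      have h5 : N.push (e C p) = N.push (e' C p) + N.Upsilon p (e C p) • N.push (N.L p) := by
        rw [← push_smul, ← push_add, ← he p hp C]
      rw [h5, inner_add_right, inner_smul_right, h3]
      ring
    rw [D_e_eq hU h h' he hp B]
    simp only [inner_add_left, inner_smul_left, inner_L_push, h2, h4]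
    ring
  simp only [h1, Fin.sum_univ_two, UpsilonSq]
  ring

/-- Start from `-g(Lbar, D_A e_B)` with `D_A e_B = D_A e'_B + e_A(Υ_B) L + Υ_B D_A L`. The first
term yields `χbar'`, the `ηbar'` term (from the `Υ_A L` part of `e_A`), connection coefficients and
`+|Υ|² χ'`; the last yields `-2 Υ_B ζ_A`. Completing `2 ∇_A Υ_B` absorbs the quadratic part of `ζ_A`
and costs `2 |Υ|² χ'`, whence the final coefficient `-1`. -/
theorem chibar_e_e (hU : IsOpen U)
    (h : N.IsFermiNullFrame v Lbar e U) (h' : N.IsFermiNullFrame N.s Lbar' e' U)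
    (he : ∀ q ∈ U, ∀ A, e A q = e' A q + N.Upsilon q (e A q) • N.L q) (hp : p ∈ U)
    (A B : Fin 2) :
    N.chibar Lbar p (e A p) (e B p) = N.chibar Lbar' p (e' A p) (e' B p) +
      2 * N.Upsilon p (e A p) * N.etabar Lbar' p (e' B p) -
      2 * N.zeta Lbar' p (e' A p) * N.Upsilon p (e B p) +
      2 * (dirDeriv (fun q ↦ N.Upsilon q (e B q)) p (e A p) -
        ∑ C, N.inner p (N.D (fun q ↦ N.push (e B q)) p (e A p)) (N.push (e C p)) *
          N.Upsilon p (e C p)) -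
      N.UpsilonSq e p * N.chi p (e' A p) (e' B p) := by
  rw [slashDForm_e_e hU h h' he hp]
  have h1 : N.inner p (Lbar p) (N.D (fun q ↦ N.push (N.L q)) p (e A p)) =
      2 * (N.zeta Lbar' p (e' A p) + ∑ C, N.chi p (e' A p) (e' C p) * N.Upsilon p (e C p)) := by
    rw [← zeta_e h h' hp (he p hp), inner_comm]
    unfold zeta
    ring
  have h2 : N.inner p (Lbar' p) (N.D (fun q ↦ N.push (e' B q)) p (e A p)) =
      - N.chibar Lbar' p (e' A p) (e' B p) -
        2 * N.Upsilon p (e A p) * N.etabar Lbar' p (e' B p) := by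
    have h3 := h'.inner_D_Lbar_e hU hp B (e A p)
    have h4 : N.D Lbar' p (e A p) =
        N.D Lbar' p (e' A p) + N.Upsilon p (e A p) • N.D Lbar' p (N.L p) := by
      rw [← D_smul_right, ← D_add_right, ← he p hp A]
    rw [h4, inner_add_left, inner_smul_left] at h3
    unfold chibar etabar
    linarith
  have h5 : N.inner p (N.push (N.L p)) (N.D (fun q ↦ N.push (e' B q)) p (e A p)) =
      - N.chi p (e' A p) (e' B p) := by
    rw [inner_comm, h'.inner_L_D_e hU hp]
    unfold chi
    rw [D_L_e_eq (he p hp)]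
  have h6 : N.inner p (Lbar p) (N.D (fun q ↦ N.push (e' B q)) p (e A p)) =
      - N.chibar Lbar' p (e' A p) (e' B p) -
        2 * N.Upsilon p (e A p) * N.etabar Lbar' p (e' B p) +
      2 * ∑ C, N.inner p (N.D (fun q ↦ N.push (e' B q)) p (e A p)) (N.push (e' C p)) *
          N.Upsilon p (e C p) - N.UpsilonSq e p * N.chi p (e' A p) (e' B p) := by
    rw [Lbar_eq h h' hp (he p hp)]
    simp only [Fin.sum_univ_two, inner_add_left, inner_smul_left, h2, h5]
    simp only [N.inner_comm p (N.push _)]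
    ring
  have h7 : N.chibar Lbar p (e A p) (e B p) = _ := h.inner_D_Lbar_e hU hp B (e A p)
  rw [h7, D_e_eq hU h h' he hp B]
  simp only [inner_add_right, inner_smul_right, h1, h6, h.Lbar_L p hp]
  ring

end IsFermiNullFrame

end NullHypersurface

end NullGeometry

end

/-! ### Assembly: from frame components to arbitrary leaf-tangent vectors. -/

theorem proposition2p2 {M : Type*} [TopologicalSpace M]
    [ChartedSpace (EuclideanSpace ℝ (Fin 4)) M] [IsManifold (𝓡 4) ∞ M]
    (g : NullGeometry.LorentzMetric M)
    {H : Type*} [TopologicalSpace H] [ChartedSpace (EuclideanHalfSpace 3) H]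
    [IsManifold (𝓡∂ 3) ∞ H] (N : NullGeometry.NullHypersurface g H)
    (v : H → ℝ) (hv : N.IsFoliation v)
    (U : Set H) (hU : IsOpen U) (hUsat : N.IsGeneratorSaturated U)
    (Lbar Lbar' : ∀ p : H, TangentSpace (𝓡 4) (N.incl p))
    (e e' : Fin 2 → ∀ p : H, TangentSpace (𝓡∂ 3) p)
    (hframe : N.IsFermiNullFrame v Lbar e U)
    (hframe' : N.IsFermiNullFrame N.s Lbar' e' U)
    (hS : ∀ A, ∀ p ∈ U, N.s p = 1 → e' A p = e A p)
    (p : H) (hp : p ∈ U) (X Y : TangentSpace (𝓡∂ 3) p)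
    (hX : NullGeometry.IsLeafTangent v X) (hY : NullGeometry.IsLeafTangent v Y) :
    N.chi p X Y = N.dagger₂ e e' N.chi p X Y ∧
    N.zeta Lbar p X = N.dagger₁ e e' (N.zeta Lbar') p X
      + ∑ B, N.dagger₂ e e' N.chi p X (e B p) * N.Upsilon p (e B p) ∧
    N.etabar Lbar p X = N.dagger₁ e e' (N.etabar Lbar') p X
      + N.slashDForm e N.Upsilon p (N.L p) X ∧
    N.chibar Lbar p X Y = N.dagger₂ e e' (N.chibar Lbar') p X Y
      + 2 * N.Upsilon p X * N.dagger₁ e e' (N.etabar Lbar') p Y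
      - 2 * N.dagger₁ e e' (N.zeta Lbar') p X * N.Upsilon p Y
      + 2 * N.slashDForm e N.Upsilon p X Y
      - N.UpsilonSq e p * N.dagger₂ e e' N.chi p X Y := by
  have he : ∀ q ∈ U, ∀ A, e A q = e' A q + N.Upsilon q (e A q) • N.L q := fun q hq A ↦
    hframe.e_eq hv hU hUsat hframe' hS hq A
  have hlapse := (hv.lapse_pos p).ne'
  have hX' := hframe.eq_sum_of_isLeafTangent hp hlapse hX
  have hY' := hframe.eq_sum_of_isLeafTangent hp hlapse hY
  have ho : ∀ A B, N.inner p (N.push (e A p)) (N.push (e B p)) = if A = B then 1 else 0 :=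
    fun A B ↦ hframe.e_orthonormal A B p hp
  refine ⟨?_, ?_, ?_, ?_⟩
  · rw [N.chi_eq_sum p hX' hY']
    simp only [NullGeometry.NullHypersurface.dagger₂,
      NullGeometry.NullHypersurface.IsFermiNullFrame.chi_e_e (he p hp)]
  · rw [N.zeta_eq_sum Lbar p hX']
    simp only [NullGeometry.NullHypersurface.dagger₁, NullGeometry.NullHypersurface.dagger₂,
      hframe.zeta_e hframe' hp (he p hp), ho, Fin.sum_univ_two]
    simp
    ring
  · rw [N.etabar_eq_sum Lbar p hX', N.slashDForm_Upsilon]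
    -- Fermi propagation kills the connection term, so `(∇_L Υ)(e_B)` is just `L(Υ_B)`.
    simp only [NullGeometry.NullHypersurface.dagger₁,
      hframe.etabar_e hlapse hU hframe' he hp, hframe.inner_D_e_L hU hp hlapse,
      Fin.sum_univ_two]
    ring
  · rw [N.chibar_eq_sum Lbar p hX' hY', N.slashDForm_Upsilon_eq_sum e p Y hX',
      N.Upsilon_eq_sum p hX', N.Upsilon_eq_sum p hY']
    simp only [NullGeometry.NullHypersurface.dagger₁, NullGeometry.NullHypersurface.dagger₂,
      hframe.chibar_e_e hU hframe' he hp, Fin.sum_univ_two]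
    ring
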